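/- **Setting.** Let $(W,S)$ be a Coxeter system with length function $l$. For $T\subset S$ let $W_T$ be the subgroup generated by $T$; $T$ is *spherical* if $W_T$ is finite, and $\mathcal S$ denotes the set of spherical subsets of $S$. Let $A=\mathbf Z W$ be the group ring with standard basis $(e_w)_{w\in W}$. For $w\in W$ put $\mathrm{In}(w)=\{s\in S\mid l(ws)<l(w)\}$ and $\mathrm{In}'(w)=\{s\in S\mid l(sw)<l(w)\}$ (these are spherical subsets). For $T\in\mathcal S$ put $$a_T=\sum_{u\in W_T}e_u,\qquad h_T=\sum_{u\in W_T}(-1)^{l(u)}e_u,$$ and let $\widehat A^T$ and $\widehat H^T$ be the $\mathbf Z$-submodules of $A$ spanned by $\{a_{\mathrm{In}'(w)}e_w\mid w\in W,\ \mathrm{In}'(w)=T\}$ and by $\{e_wh_{\mathrm{In}(w)}\mid w\in W,\ \mathrm{In}(w)=T\}$, respectively. Let $X$ be a CW complex with a mirror structure, that is, a family $(X_s)_{s\in S}$ of subcomplexes. For $T\subset S$ put $X_T=\bigcap_{s\in T}X_s$ (with $X_\emptyset=X$) and $X^T=\bigcup_{s\in T}X_s$, and for $x\in X$ put $S(x)=\{s\in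 S\mid x\in X_s\}$. Let $\mathcal U=\mathcal U(W,X)$ be the quotient of $W\times X$ ($W$ discrete) by the equivalence relation $(w,x)\sim(w',x')\iff x=x'$ and $wW_{S(x)}=w'W_{S(x')}$, with the CW structure whose cells are the translates $wc$ ($w\in W$) of the cells $c$ of $X$. $H_*$ and $H^*$ denote integral cellular homology and cohomology, and $H^*_c$ denotes the cohomology of finitely supported integral cellular cochains. **Theorem.** Let $i\ge 0$. 1. If $X$ is compact and $X_U=\emptyset$ for every $U\subset S$ that is not spherical, then there is an isomorphism of abelian groups $$H^i_c(\mathcal U)\;\cong\;\bigoplus_{T\in\mathcal S}H^i(X,X^{S-T})\otimes_{\mathbf Z}\widehat A^T.$$ 2. Without any further assumption on $X$, there is an isomorphism of abelian groups $$H_i(\mathcal U)\;\cong\;\bigoplus_{T\in\mathcal S}H_i(X,X^T)\otimes_{\mathbf Z}\widehat H^T.$$ -/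

import Mathlib

open Set Metric Topology TensorProduct DirectSum

noncomputable section

/-! ### Degrees of maps between spheres -/

namespace CellularHomology

/-- The boundary of the `(n+1)`-dimensional cube `[-1,1]^(n+1)`, a topological `n`-sphere. It is the
domain of the attaching maps of the `(n+1)`-cells of a CW complex. -/
abbrev BoundarySphere (n : ℕ) : Type := sphere (0 : Fin (n + 1) → ℝ) 1

/-- The one-point compactification of the open `n`-cube, i.e. the quotient of the closed `n`-cube
by its boundary, a topological `n`-sphere. -/
abbrev QuotientSphere (n : ℕ) : Type := OnePoint (ball (0 : Fin n → ℝ) 1)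

/-- Integral singular homology of a space. -/
abbrev SingularH (n : ℕ) (A : Type) [TopologicalSpace A] : ModuleCat.{0} ℤ :=
  ((AlgebraicTopology.singularHomologyFunctor (ModuleCat.{0} ℤ) n).obj (ModuleCat.of ℤ ℤ)).obj
    (TopCat.of A)

/-- The map induced by a continuous map on integral singular homology. -/
def singularHMap (n : ℕ) {A B : Type} [TopologicalSpace A] [TopologicalSpace B] (f : C(A, B)) :
    SingularH n A →ₗ[ℤ] SingularH n B :=
  (((AlgebraicTopology.singularHomologyFunctor (ModuleCat.{0} ℤ) n).obj
    (ModuleCat.of ℤ ℤ)).map (TopCat.ofHom f)).hom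

theorem singularHMap_comp (n : ℕ) {A B D : Type} [TopologicalSpace A] [TopologicalSpace B]
    [TopologicalSpace D] (g : C(B, D)) (f : C(A, B)) :
    singularHMap n (g.comp f) = (singularHMap n g).comp (singularHMap n f) := by
  simp [singularHMap, TopCat.ofHom_comp]

/-- Reduced singular homology: the kernel of the map induced by the map to a point. -/
def reducedH (n : ℕ) (A : Type) [TopologicalSpace A] : Submodule ℤ (SingularH n A) :=
  LinearMap.ker (singularHMap n (ContinuousMap.const A ()))

open scoped Classical in
/-- The underlying function of the standard map between the two models of the `n`-sphere: it is the
projection `(x₀, x₁, …, xₙ) ↦ (x₁, …, xₙ)` on the open face `x₀ = 1` of the cube and collapses the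
rest of the boundary of the cube to the point at infinity. -/
def faceCollapseFun (n : ℕ) (x : BoundarySphere n) : QuotientSphere n :=
  if h : x.1 0 = 1 ∧ Fin.tail x.1 ∈ ball (0 : Fin n → ℝ) 1 then
    ((⟨Fin.tail x.1, h.2⟩ : ball (0 : Fin n → ℝ) 1) : QuotientSphere n)
  else OnePoint.infty

theorem faceCollapseFun_preimage_coe (n : ℕ) (V : Set (ball (0 : Fin n → ℝ) 1)) :
    faceCollapseFun n ⁻¹' ((↑) '' V) =
      {x | x.1 0 = 1} ∩ {x | (Fin.tail x.1 : Fin n → ℝ) ∈ ((↑) '' V : Set (Fin n → ℝ))} := by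
  ext x
  simp only [mem_preimage, mem_inter_iff, mem_ofPred_eq]
  constructor
  · rintro ⟨y, hy, hxy⟩
    unfold faceCollapseFun at hxy
    split_ifs at hxy with h
    · have : y = ⟨Fin.tail x.1, h.2⟩ := OnePoint.coe_injective hxy
      exact ⟨h.1, y, hy, by rw [this]⟩
    · exact absurd hxy (OnePoint.coe_ne_infty y)
  · rintro ⟨h0, y, hy, hxy⟩
    have h1 : Fin.tail x.1 ∈ ball (0 : Fin n → ℝ) 1 := hxy ▸ y.2
    refine ⟨y, hy, ?_⟩
    unfold faceCollapseFun
    rw [dif_pos ⟨h0, h1⟩]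
    exact congrArg _ (Subtype.ext hxy)

theorem abs_zero_eq_one_of_tail_mem (n : ℕ) (x : BoundarySphere n)
    (h : Fin.tail x.1 ∈ ball (0 : Fin n → ℝ) 1) : |x.1 0| = 1 := by
  have hx : ‖x.1‖ = 1 := by simp
  have ht : ‖Fin.tail x.1‖ < 1 := by simpa using h
  have h0 : |x.1 0| ≤ 1 := by
    exact (norm_le_pi_norm x.1 0).trans_eq hx
  refine le_antisymm h0 ?_
  by_contra hlt
  rw [not_le] at hlt
  have : ‖x.1‖ < 1 := by
    rw [pi_norm_lt_iff one_pos]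
    intro i
    refine Fin.cases hlt (fun j => ?_) i
    exact (norm_le_pi_norm (Fin.tail x.1) j).trans_lt ht
  exact this.ne hx

theorem continuous_faceCollapseFun (n : ℕ) : Continuous (faceCollapseFun n) := by
  have ctail : Continuous fun x : BoundarySphere n => (Fin.tail x.1 : Fin n → ℝ) :=
    continuous_pi fun j => (continuous_apply j.succ).comp continuous_subtype_val
  have c0 : Continuous fun x : BoundarySphere n => x.1 0 :=
    (continuous_apply 0).comp continuous_subtype_val
  refine continuous_def.2 fun s hs => ?_
  by_cases hi : OnePoint.infty ∈ s
  · rw [OnePoint.isOpen_iff_of_mem' hi] at hs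
    rw [← isClosed_compl_iff, ← preimage_compl]
    have e : sᶜ = ((↑) '' ((↑) ⁻¹' s : Set (ball (0 : Fin n → ℝ) 1))ᶜ : Set (QuotientSphere n)) := by
      ext y
      induction y using OnePoint.rec with
      | infty => simp [hi]
      | coe y => simp
    rw [e, faceCollapseFun_preimage_coe]
    exact (isClosed_eq c0 continuous_const).inter
      ((hs.1.image continuous_subtype_val).isClosed.preimage ctail)
  · have e : s = ((↑) '' ((↑) ⁻¹' s : Set (ball (0 : Fin n → ℝ) 1)) : Set (QuotientSphere n)) := by
      ext y
      induction y using OnePoint.rec with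
      | infty => simp [hi]
      | coe y => simp
    rw [OnePoint.isOpen_iff_of_notMem hi] at hs
    rw [e, faceCollapseFun_preimage_coe]
    have ho := (isOpen_ball.isOpenMap_subtype_val _ hs).preimage ctail
    convert (isOpen_lt continuous_const c0 : IsOpen {x : BoundarySphere n | 0 < x.1 0}).inter ho
      using 1
    ext x
    simp only [mem_inter_iff, mem_ofPred_eq, mem_preimage]
    refine and_congr_left ?_
    rintro ⟨y, -, hy⟩
    have := abs_zero_eq_one_of_tail_mem n x (hy ▸ y.2)
    constructor
    · intro h
      rw [h]
      exact one_pos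
    · intro h
      rwa [abs_of_pos h] at this

/-- The standard map `∂[-1,1]^(n+1) → [-1,1]^n / ∂[-1,1]^n` which collapses everything except the
open face `x₀ = 1`. It is a homotopy equivalence of `n`-spheres, used to orient the cubes
("outward normal first"). -/
def faceCollapse (n : ℕ) : C(BoundarySphere n, QuotientSphere n) :=
  ⟨faceCollapseFun n, continuous_faceCollapseFun n⟩

/-- `f` has degree `d` if `f` induces on reduced `n`-th homology `d` times the isomorphism induced
by the standard map. -/
def HasDegree {n : ℕ} (f : C(BoundarySphere n, QuotientSphere n)) (d : ℤ) : Prop :=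
  ∀ x ∈ reducedH n (BoundarySphere n), singularHMap n f x = d • singularHMap n (faceCollapse n) x

open scoped Classical in
/-- The degree of a map between (the two models of) the `n`-sphere. As reduced `n`-th homology of
the `n`-sphere is infinite cyclic, there is exactly one `d` with `HasDegree f d`. -/
def degree {n : ℕ} (f : C(BoundarySphere n, QuotientSphere n)) : ℤ :=
  if HasDegree f 0 then 0
  else if h : ∃ d, HasDegree f d then h.choose else 0

theorem degree_const {n : ℕ} (y : QuotientSphere n) :
    degree (ContinuousMap.const (BoundarySphere n) y) = 0 := by
  have h : HasDegree (ContinuousMap.const (BoundarySphere n) y) 0 := by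
    intro x hx
    have e : ContinuousMap.const (BoundarySphere n) y =
        (ContinuousMap.const Unit y).comp (ContinuousMap.const (BoundarySphere n) ()) := rfl
    have hx' : singularHMap n (ContinuousMap.const (BoundarySphere n) ()) x = 0 := hx
    rw [e, singularHMap_comp, LinearMap.comp_apply, hx', map_zero, zero_smul]
  simp [degree, h]

/-! ### Cellular chains and cochains of a CW complex -/

variable {X : Type*} [TopologicalSpace X] (C : Set X) [CWComplex C]

open CWComplex

open scoped Classical in
/-- The map which collapses the complement of the open `n`-cell `j` to a point and identifies
the quotient (of the `n`-skeleton) with a sphere through the characteristic map of `j`. -/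
def collapse (n : ℕ) (j : cell C n) (x : X) : QuotientSphere n :=
  if h : x ∈ openCell n j then
    ((⟨(map n j).symm x, by
        rw [← RelCWComplex.source_eq n j]
        refine (map n j).map_target ?_
        rw [← (map n j).image_source_eq_target, RelCWComplex.source_eq n j]
        exact h⟩ : ball (0 : Fin n → ℝ) 1) : QuotientSphere n)
  else OnePoint.infty

theorem collapse_preimage_coe (n : ℕ) (j : cell C n) (V : Set (ball (0 : Fin n → ℝ) 1)) :
    collapse C n j ⁻¹' ((↑) '' V) = map n j '' ((↑) '' V) := by
  ext x
  constructor
  · rintro ⟨y, hy, hxy⟩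
    unfold collapse at hxy
    split_ifs at hxy with h
    · refine ⟨y, mem_image_of_mem _ hy, ?_⟩
      rw [OnePoint.coe_injective hxy]
      refine (map n j).right_inv ?_
      rw [← (map n j).image_source_eq_target, RelCWComplex.source_eq n j]
      exact h
    · exact absurd hxy (OnePoint.coe_ne_infty y)
  · rintro ⟨_, ⟨y, hy, rfl⟩, rfl⟩
    have h : map n j y.1 ∈ openCell n j := mem_image_of_mem _ y.2
    refine ⟨y, hy, ?_⟩
    unfold collapse
    rw [dif_pos h]
    refine congrArg _ (Subtype.ext ?_)
    exact ((map n j).left_inv (by rw [RelCWComplex.source_eq n j]; exact y.2)).symm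

theorem continuous_attach (n : ℕ) (c : cell C (n + 1)) :
    Continuous fun x : BoundarySphere n => map (n + 1) c x.1 :=
  ((continuousOn (n + 1) c).mono sphere_subset_closedBall).comp_continuous
    continuous_subtype_val fun x => x.2

theorem continuous_collapse_attach [T2Space X] (n : ℕ) (c : cell C (n + 1)) (c' : cell C n) :
    Continuous fun x : BoundarySphere n => collapse C n c' (map (n + 1) c x.1) := by
  have hc' := continuousOn n c'
  have hdisj : Disjoint (CWComplex.skeletonLT C n : Set X) (openCell n c') :=
    CWComplex.disjoint_skeletonLT_openCell le_rfl
  refine continuous_def.2 fun s hs => ?_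
  change IsOpen ((fun x : BoundarySphere n => map (n + 1) c x.1) ⁻¹' (collapse C n c' ⁻¹' s))
  by_cases hi : OnePoint.infty ∈ s
  · rw [OnePoint.isOpen_iff_of_mem' hi] at hs
    rw [← isClosed_compl_iff, ← preimage_compl, ← preimage_compl]
    have e : sᶜ = ((↑) '' ((↑) ⁻¹' s : Set (ball (0 : Fin n → ℝ) 1))ᶜ : Set (QuotientSphere n)) := by
      ext y
      induction y using OnePoint.rec with
      | infty => simp [hi]
      | coe y => simp
    rw [e, collapse_preimage_coe]
    refine IsClosed.preimage (continuous_attach C n c) (IsCompact.isClosed ?_)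
    refine (hs.1.image continuous_subtype_val).image_of_continuousOn (hc'.mono ?_)
    rintro _ ⟨y, -, rfl⟩
    exact ball_subset_closedBall y.2
  · have e : s = ((↑) '' ((↑) ⁻¹' s : Set (ball (0 : Fin n → ℝ) 1)) : Set (QuotientSphere n)) := by
      ext y
      induction y using OnePoint.rec with
      | infty => simp [hi]
      | coe y => simp
    rw [OnePoint.isOpen_iff_of_notMem hi] at hs
    rw [e, collapse_preimage_coe]
    have hV := isOpen_ball.isOpenMap_subtype_val _ hs
    generalize hVdef : (Subtype.val '' (OnePoint.some ⁻¹' s) : Set (Fin n → ℝ)) = V at hV ⊢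
    have hVb : V ⊆ ball 0 1 := by
      rw [← hVdef]
      rintro _ ⟨y, -, rfl⟩
      exact y.2
    obtain ⟨I, hI⟩ := CWComplex.cellFrontier_subset_finite_openCell (C := C) (n + 1) c
    -- The complement of `map n c' '' V` in the image of the attaching map lies in a closed set.
    have hF : IsClosed ((CWComplex.skeletonLT C n : Set X) ∪
        (⋃ j ∈ (I n : Set (cell C n)) \ {c'}, closedCell n j) ∪
        map n c' '' (closedBall 0 1 \ V)) := by
      refine ((CWComplex.Subcomplex.closed _).union ?_).union ?_
      · exact ((I n).finite_toSet.subset sdiff_subset).isClosed_biUnion fun j _ =>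
          CWComplex.isClosed_closedCell
      · exact (((isCompact_closedBall _ _).diff hV).image_of_continuousOn
          (hc'.mono sdiff_subset)).isClosed
    rw [← isClosed_compl_iff]
    convert hF.preimage (continuous_attach C n c) using 1
    ext x
    simp only [mem_compl_iff, mem_preimage]
    constructor
    · intro hx
      have hfr : map (n + 1) c x.1 ∈ cellFrontier (n + 1) c := mem_image_of_mem _ x.2
      have := hI hfr
      simp only [mem_iUnion] at this
      obtain ⟨k, hk, j, hj, hxj⟩ := this
      rcases Nat.lt_succ_iff_lt_or_eq.1 hk with hkn | rfl
      · left; left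
        exact CWComplex.skeletonLT_mono (C := C) (by exact_mod_cast hkn)
          (CWComplex.openCell_subset_skeletonLT k j hxj)
      · by_cases hjc : j = c'
        · right
          subst hjc
          obtain ⟨y, hy, hyx⟩ := hxj
          exact ⟨y, ⟨ball_subset_closedBall hy, fun hyV => hx ⟨y, hyV, hyx⟩⟩, hyx⟩
        · left; right
          exact mem_biUnion (⟨hj, hjc⟩ : j ∈ (I k : Set (cell C k)) \ {c'})
            (openCell_subset_closedCell k j hxj)
    · rintro ((h | h) | h) ⟨v, hv, hvx⟩
      · exact disjoint_left.1 hdisj h (hvx ▸ mem_image_of_mem _ (hVb hv))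
      · simp only [mem_iUnion] at h
        obtain ⟨j, ⟨-, hj⟩, hxj⟩ := h
        have hxo : map (n + 1) c x.1 ∈ openCell n c' := hvx ▸ mem_image_of_mem _ (hVb hv)
        rw [← cellFrontier_union_openCell_eq_closedCell] at hxj
        rcases hxj with hxj | hxj
        · exact disjoint_left.1 hdisj (CWComplex.cellFrontier_subset_skeletonLT n j hxj) hxo
        · refine disjoint_left.1 (CWComplex.disjoint_openCell_of_ne ?_) hxj hxo
          rintro ⟨⟩
          exact hj rfl
      · obtain ⟨z, ⟨hz, hzV⟩, hzx⟩ := h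
        have hxo : map (n + 1) c x.1 ∈ openCell n c' := hvx ▸ mem_image_of_mem _ (hVb hv)
        by_cases hzb : z ∈ ball (0 : Fin n → ℝ) 1
        · refine hzV ?_
          have : z = v := (map n c').injOn (by rwa [RelCWComplex.source_eq n c'])
            (by rw [RelCWComplex.source_eq n c']; exact hVb hv) (hzx.trans hvx.symm)
          rwa [this]
        · have hzs : z ∈ sphere (0 : Fin n → ℝ) 1 := by
            rw [← closedBall_sdiff_ball]
            exact ⟨hz, hzb⟩
          exact disjoint_left.1 hdisj (CWComplex.cellFrontier_subset_skeletonLT n c'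
            (hzx ▸ mem_image_of_mem _ hzs)) hxo

variable [T2Space X]

/-- The incidence number `[c : c']` of an `(n+1)`-cell `c` and an `n`-cell `c'`: the degree of
the attaching map of `c` followed by the collapse of the `n`-skeleton onto the sphere of `c'`. -/
def incidence (n : ℕ) (c : cell C (n + 1)) (c' : cell C n) : ℤ :=
  degree ⟨_, continuous_collapse_attach C n c c'⟩

theorem incidence_eq_zero (n : ℕ) (c : cell C (n + 1)) (c' : cell C n)
    (h : Disjoint (cellFrontier (n + 1) c) (openCell n c')) : incidence C n c c' = 0 := by
  have e : (⟨_, continuous_collapse_attach C n c c'⟩ : C(BoundarySphere n, QuotientSphere n)) =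
      ContinuousMap.const _ OnePoint.infty := by
    ext1 x
    have hx : map (n + 1) c x.1 ∉ openCell n c' :=
      disjoint_left.1 h (mem_image_of_mem _ x.2)
    simp [collapse, hx]
  rw [incidence, e, degree_const]

theorem finite_incidence (n : ℕ) (c : cell C (n + 1)) :
    (Function.support (incidence C n c)).Finite := by
  obtain ⟨I, hI⟩ := CWComplex.cellFrontier_subset_finite_openCell (C := C) (n + 1) c
  refine (I n).finite_toSet.subset fun c' hc' => ?_
  by_contra hn
  refine hc' (incidence_eq_zero C n c c' ?_)
  refine Disjoint.mono_left hI ?_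
  simp only [disjoint_iUnion_left]
  intro m _ j hj
  refine CWComplex.disjoint_openCell_of_ne ?_
  rintro ⟨⟩
  exact hn hj

/-- Cellular `n`-chains: the free abelian group on the `n`-cells. -/
abbrev Chains (n : ℕ) : Type _ := cell C n →₀ ℤ

/-- Cellular `n`-cochains: integer valued functions on the set of `n`-cells. -/
abbrev Cochains (n : ℕ) : Type _ := cell C n → ℤ

/-- The boundary of a cell, `∂ c = ∑ [c : c'] c'`. -/
def cellBoundary (n : ℕ) (c : cell C (n + 1)) : Chains C n :=
  Finsupp.ofSupportFinite (incidence C n c) (finite_incidence C n c)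

/-- The cellular boundary map. -/
def boundary (n : ℕ) : Chains C (n + 1) →ₗ[ℤ] Chains C n :=
  Finsupp.linearCombination ℤ (cellBoundary C n)

/-- The cellular coboundary map, `(δ f)(c) = ∑ [c : c'] f(c')`. -/
def coboundary (n : ℕ) : Cochains C n →ₗ[ℤ] Cochains C (n + 1) where
  toFun f c := (cellBoundary C n c).sum fun c' a => a * f c'
  map_add' f g := by
    funext c
    simp [Finsupp.sum, mul_add, Finset.sum_add_distrib]
  map_smul' r f := by
    funext c
    simp [Finsupp.sum, Finset.mul_sum, mul_left_comm]

/-! ### Cellular homology -/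

/-- The chains of a subcomplex `Y`: those supported on the cells contained in `Y`. -/
def chainsIn (Y : Set X) (n : ℕ) : Submodule ℤ (Chains C n) :=
  Finsupp.supported ℤ ℤ {c | openCell n c ⊆ Y}

/-- Relative cycles: chains of the complex whose boundary is a chain of `Y`. -/
def relCycles (Y : Set X) : (n : ℕ) → Submodule ℤ (Chains C n)
  | 0 => ⊤
  | n + 1 => (chainsIn C Y n).comap (boundary C n)

/-- Relative boundaries: boundaries modulo chains of `Y`. -/
def relBoundaries (Y : Set X) (n : ℕ) : Submodule ℤ (Chains C n) :=
  LinearMap.range (boundary C n) ⊔ chainsIn C Y n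

/-- Relative cellular homology `H_n(C, Y)` of a CW complex modulo a subcomplex, as relative cycles
modulo relative boundaries. (Relative boundaries are relative cycles; `submoduleOf` only views them
as a subgroup of the relative cycles.) -/
abbrev RelHomology (Y : Set X) (n : ℕ) : Type _ :=
  relCycles C Y n ⧸ (relBoundaries C Y n).submoduleOf (relCycles C Y n)

/-- Cellular homology `H_n(C)`. -/
abbrev Homology (n : ℕ) : Type _ := RelHomology C ∅ n

/-! ### Cellular cohomology -/

/-- The cocycles among a family of groups of cochains. -/
def cocycles (K : (n : ℕ) → Submodule ℤ (Cochains C n)) (n : ℕ) : Submodule ℤ (Cochains C n) :=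
  K n ⊓ LinearMap.ker (coboundary C n)

/-- The coboundaries of cochains from a family of groups of cochains. -/
def coboundaries (K : (n : ℕ) → Submodule ℤ (Cochains C n)) :
    (n : ℕ) → Submodule ℤ (Cochains C n)
  | 0 => ⊥
  | n + 1 => (K n).map (coboundary C n)

/-- The cohomology of a subcomplex `K` of the cellular cochain complex, as cocycles modulo
coboundaries. (Coboundaries are cocycles; `submoduleOf` only views them as a subgroup.) -/
abbrev CohomologyOf (K : (n : ℕ) → Submodule ℤ (Cochains C n)) (n : ℕ) : Type _ :=
  cocycles C K n ⧸ (coboundaries C K n).submoduleOf (cocycles C K n)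

/-- The relative cochains: those vanishing on the cells contained in `Y`. -/
def relCochains (Y : Set X) (n : ℕ) : Submodule ℤ (Cochains C n) where
  carrier := {f | ∀ c : cell C n, openCell n c ⊆ Y → f c = 0}
  add_mem' hf hg c hc := by simp [hf c hc, hg c hc]
  zero_mem' _ _ := rfl
  smul_mem' r f hf c hc := by simp [hf c hc]

/-- The finitely supported cochains. -/
def finiteCochains (n : ℕ) : Submodule ℤ (Cochains C n) where
  carrier := {f | (Function.support f).Finite}
  add_mem' hf hg := (hf.union hg).subset (Function.support_add _ _)
  zero_mem' := by simp
  smul_mem' r f hf := hf.subset (Function.support_const_smul_subset r f)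

/-- Relative cellular cohomology `H^n(C, Y)` of a CW complex modulo a subcomplex. -/
abbrev RelCohomology (Y : Set X) (n : ℕ) : Type _ := CohomologyOf C (relCochains C Y) n

/-- Finitely supported cellular cohomology `H^n_c(C)` of a (locally finite) CW complex. -/
abbrev FiniteCohomology (n : ℕ) : Type _ := CohomologyOf C (finiteCochains C) n

end CellularHomology

/-! ### Coxeter groups and the group ring -/

namespace CoxeterDavis

variable {S : Type*} {M : CoxeterMatrix S} {W : Type*} [Group W] (cs : CoxeterSystem M W)

/-- The special subgroup `W_T` generated by `T ⊆ S`. -/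
def special (T : Set S) : Subgroup W := Subgroup.closure (cs.simple '' T)

theorem special_mono {T T' : Set S} (h : T ⊆ T') : special cs T ≤ special cs T' :=
  Subgroup.closure_mono (image_mono h)

/-- `T ⊆ S` is spherical if `W_T` is finite. -/
def IsSpherical (T : Set S) : Prop := Finite (special cs T)

/-- `In(w) = {s | l(ws) < l(w)}`. -/
def rightIn (w : W) : Set S := {s | cs.length (w * cs.simple s) < cs.length w}

/-- `In'(w) = {s | l(sw) < l(w)}`. -/
def leftIn (w : W) : Set S := {s | cs.length (cs.simple s * w) < cs.length w}

/-- The symmetrization `a_T = ∑_{u ∈ W_T} e_u` in the group ring, for `T` spherical. -/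
def symmetrization (T : Set S) : MonoidAlgebra ℤ W :=
  ∑ᶠ u : special cs T, MonoidAlgebra.of ℤ W u

/-- The alternation `h_T = ∑_{u ∈ W_T} (-1)^{l(u)} e_u` in the group ring, for `T` spherical. -/
def alternation (T : Set S) : MonoidAlgebra ℤ W :=
  ∑ᶠ u : special cs T, (-1 : ℤ) ^ cs.length (u : W) • MonoidAlgebra.of ℤ W u

/-- `Â^T`, the span of the elements `b'_w = a_{In'(w)} e_w` with `In'(w) = T`. -/
def AHat (T : Set S) : Submodule ℤ (MonoidAlgebra ℤ W) :=
  Submodule.span ℤ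
    ((fun w => symmetrization cs (leftIn cs w) * MonoidAlgebra.of ℤ W w) '' {w | leftIn cs w = T})

/-- `Ĥ^T`, the span of the elements `b_w = e_w h_{In(w)}` with `In(w) = T`. -/
def HHat (T : Set S) : Submodule ℤ (MonoidAlgebra ℤ W) :=
  Submodule.span ℤ
    ((fun w => MonoidAlgebra.of ℤ W w * alternation cs (rightIn cs w)) '' {w | rightIn cs w = T})

/-! ### Mirror structures and the basic construction -/

variable {X : Type*} [TopologicalSpace X] [CWComplex (univ : Set X)]

/-- A mirror structure on a CW complex `X`: a family of subcomplexes `X_s` indexed by `S`. -/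
abbrev Mirrors (S X : Type*) [TopologicalSpace X] [CWComplex (univ : Set X)] : Type _ :=
  S → CWComplex.Subcomplex (univ : Set X)

variable (m : Mirrors S X)

/-- `X^T`, the union of the mirrors `X_s` with `s ∈ T`. -/
def mirrorUnion (T : Set S) : Set X := ⋃ s ∈ T, (m s : Set X)

/-- `X_T`, the intersection of the mirrors `X_s` with `s ∈ T`; it is `X` for empty `T`. -/
def mirrorInter (T : Set S) : Set X := ⋂ s ∈ T, (m s : Set X)

/-- `S(x) = {s | x ∈ X_s}`. -/
def mirrorsAt (x : X) : Set S := {s | x ∈ (m s : Set X)}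

/-- `S(c) = {s | c ⊆ X_s}` for a cell `c`. -/
def mirrorsOf (n : ℕ) (c : RelCWComplex.cell (univ : Set X) n) : Set S :=
  {s | RelCWComplex.openCell n c ⊆ (m s : Set X)}

/-- The equivalence relation on `W × X` of the basic construction: `(w, x) ∼ (w', x')` iff `x = x'`
and `w W_{S(x)} = w' W_{S(x')}`. -/
def basicSetoid : Setoid (W × X) where
  r p q := p.2 = q.2 ∧ p.1⁻¹ * q.1 ∈ special cs (mirrorsAt m p.2)
  iseqv :=
    { refl := fun p => ⟨rfl, by simp [one_mem]⟩
      symm := by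
        rintro ⟨w, x⟩ ⟨v, y⟩ ⟨h, h'⟩
        obtain rfl : x = y := h
        exact ⟨rfl, by simpa using inv_mem h'⟩
      trans := by
        rintro ⟨w, x⟩ ⟨v, y⟩ ⟨u, z⟩ ⟨h, h'⟩ ⟨k, k'⟩
        obtain rfl : x = y := h
        obtain rfl : x = z := k
        exact ⟨rfl, by simpa [mul_assoc] using mul_mem h' k'⟩ }

/-- The basic construction `𝒰(W, X) = (W × X) / ∼`. -/
def BasicConstruction : Type _ := Quotient (basicSetoid cs m)

/-- The quotient topology on `𝒰(W, X)`, where `W` is discrete. -/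
instance : TopologicalSpace (BasicConstruction cs m) :=
  let _ : TopologicalSpace W := ⊥
  inferInstanceAs (TopologicalSpace (Quotient (basicSetoid cs m)))

namespace BasicConstruction

/-- The class `[w, x]` of `(w, x)`. -/
def mk (w : W) (x : X) : BasicConstruction cs m := Quotient.mk (basicSetoid cs m) (w, x)

theorem mk_eq_mk {w w' : W} {x x' : X} : mk cs m w x = mk cs m w' x' ↔
    x = x' ∧ w⁻¹ * w' ∈ special cs (mirrorsAt m x) :=
  Quotient.eq (r := basicSetoid cs m)

theorem exists_mk (u : BasicConstruction cs m) : ∃ w x, mk cs m w x = u := by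
  obtain ⟨⟨w, x⟩, rfl⟩ := Quotient.exists_rep u
  exact ⟨w, x, rfl⟩

/-- The projection `[w, x] ↦ x`. -/
def proj : BasicConstruction cs m → X := Quotient.lift Prod.snd fun _ _ h => h.1

@[simp] theorem proj_mk (w : W) (x : X) : proj cs m (mk cs m w x) = x := rfl

theorem continuous_mk (w : W) : Continuous (mk cs m w) := by
  let _ : TopologicalSpace W := ⊥
  exact continuous_quotient_mk'.comp (by fun_prop : Continuous fun x : X => (w, x))

theorem continuous_proj : Continuous (proj cs m) := by
  let _ : TopologicalSpace W := ⊥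
  exact continuous_snd.quotient_lift _

theorem isClosed_iff {A : Set (BasicConstruction cs m)} :
    IsClosed A ↔ ∀ w, IsClosed (mk cs m w ⁻¹' A) := by
  refine ⟨fun h w => h.preimage (continuous_mk cs m w), fun h => ?_⟩
  let _ : TopologicalSpace W := ⊥
  have : DiscreteTopology W := ⟨rfl⟩
  rw [← isOpen_compl_iff]
  refine isOpen_coinduced.2 ?_
  have e : Quotient.mk (basicSetoid cs m) ⁻¹' Aᶜ = ⋃ w : W, {w} ×ˢ (mk cs m w ⁻¹' A)ᶜ := by
    ext ⟨w, x⟩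
    simp only [mem_preimage, mem_iUnion, mem_prod, mem_singleton_iff, exists_eq_left']
    rfl
  change IsOpen (Quotient.mk (basicSetoid cs m) ⁻¹' Aᶜ)
  rw [e]
  exact isOpen_iUnion fun w => (isOpen_discrete _).prod (h w).isOpen_compl

end BasicConstruction

section CW

variable {cs m}

open RelCWComplex

theorem mirrorsAt_eq [T2Space X] {n : ℕ} {c : cell (univ : Set X) n} {x : X}
    (hx : x ∈ openCell n c) : mirrorsAt m x = mirrorsOf m n c := by
  ext s
  refine ⟨fun h => ?_, fun h => h hx⟩
  by_contra hn
  have : c ∉ (m s).I n := fun hc => hn (CWComplex.Subcomplex.openCell_subset_of_mem (m s) hc)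
  exact disjoint_left.1
    (CWComplex.Subcomplex.disjoint_openCell_subcomplex_of_not_mem (m s) this) hx h

theorem mirrorsOf_subset [T2Space X] {n : ℕ} {c : cell (univ : Set X) n} {x : X}
    (hx : x ∈ closedCell n c) : mirrorsOf m n c ⊆ mirrorsAt m x := by
  intro s hs
  rw [← CWComplex.closure_openCell_eq_closedCell] at hx
  exact closure_minimal hs (CWComplex.Subcomplex.closed (m s)) hx

end CW

namespace BasicConstruction

open RelCWComplex

/-- The `n`-cells of `𝒰(W, X)` are the translates `wc` of the `n`-cells `c` of `X`; `wc` is given by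
`c` and the coset `w W_{S(c)}`. -/
abbrev Cell (n : ℕ) : Type _ :=
  Σ c : cell (univ : Set X) n, W ⧸ special cs (mirrorsOf m n c)

/-- The characteristic map of the cell `wc` of `𝒰(W, X)`: the characteristic map of `c` followed by
`x ↦ [w, x]`. On the closed ball it does not depend on the representative `w` of the coset. -/
def charMap (n : ℕ) (e : Cell cs m n) :
    PartialEquiv (Fin n → ℝ) (BasicConstruction cs m) where
  toFun y := mk cs m e.2.out (map n e.1 y)
  invFun u := (map n e.1).symm (proj cs m u)
  source := ball 0 1
  target := mk cs m e.2.out '' openCell n e.1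
  map_source' y hy := mem_image_of_mem _ (mem_image_of_mem _ hy)
  map_target' := by
    rintro _ ⟨_, ⟨y, hy, rfl⟩, rfl⟩
    rw [proj_mk, (map n e.1).left_inv (by rwa [RelCWComplex.source_eq n e.1])]
    exact hy
  left_inv' y hy := by
    rw [proj_mk, (map n e.1).left_inv (by rwa [RelCWComplex.source_eq n e.1])]
  right_inv' := by
    rintro _ ⟨_, ⟨y, hy, rfl⟩, rfl⟩
    rw [proj_mk, (map n e.1).left_inv (by rwa [RelCWComplex.source_eq n e.1])]

/-- An arbitrary union of mirrors is closed. -/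
theorem isClosed_mirrorUnion [T2Space X] (T : Set S) : IsClosed (mirrorUnion m T) := by
  refine CWComplex.isClosed_of_disjoint_openCell_or_isClosed_inter_closedCell
    (C := (univ : Set X)) (subset_univ _) fun n _ c => ?_
  by_cases h : ∃ s ∈ T, c ∈ (m s).I n
  · right
    obtain ⟨s, hs, hc⟩ := h
    have : closedCell n c ⊆ mirrorUnion m T :=
      (CWComplex.Subcomplex.closedCell_subset_of_mem (m s) hc).trans
        (subset_biUnion_of_mem (u := fun s => (m s : Set X)) hs)
    rw [inter_eq_right.2 this]
    exact isClosed_closedCell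
  · left
    push Not at h
    refine Disjoint.symm ?_
    simp only [mirrorUnion, disjoint_iUnion_right]
    exact fun s hs =>
      CWComplex.Subcomplex.disjoint_openCell_subcomplex_of_not_mem (m s) (h s hs)

instance [T2Space X] : T2Space (BasicConstruction cs m) := by
  refine ⟨fun u v huv => ?_⟩
  obtain ⟨w, x, rfl⟩ := exists_mk cs m u
  obtain ⟨w', x', rfl⟩ := exists_mk cs m v
  by_cases hx : x = x'
  · subst hx
    -- The union over `g ∈ W_{S(x)}` of the sets `vgV`, with `V ⊆ X` the open set of points that
    -- lie only on mirrors through `x`.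
    let N : W → Set (BasicConstruction cs m) := fun v =>
      {u | ∃ g ∈ special cs (mirrorsAt m x), ∃ y ∉ mirrorUnion m (mirrorsAt m x)ᶜ,
        mk cs m (v * g) y = u}
    have hsub : ∀ y ∉ mirrorUnion m (mirrorsAt m x)ᶜ, mirrorsAt m y ⊆ mirrorsAt m x := by
      intro y hy s hs
      by_contra hn
      exact hy (mem_biUnion (t := fun s => (m s : Set X)) hn hs)
    have hmem : ∀ v z y, mk cs m z y ∈ N v ↔
        v⁻¹ * z ∈ special cs (mirrorsAt m x) ∧ y ∉ mirrorUnion m (mirrorsAt m x)ᶜ := by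
      intro v z y
      constructor
      · rintro ⟨g, hg, y', hy', h⟩
        obtain ⟨rfl, h2⟩ := (mk_eq_mk cs m).1 h
        refine ⟨?_, hy'⟩
        have := mul_mem hg (special_mono cs (hsub _ hy') h2)
        simpa [mul_assoc] using this
      · rintro ⟨h1, h2⟩
        exact ⟨v⁻¹ * z, h1, y, h2, by simp⟩
    have hopen : ∀ v, IsOpen (N v) := by
      intro v
      rw [← isClosed_compl_iff, isClosed_iff]
      intro z
      by_cases hz : v⁻¹ * z ∈ special cs (mirrorsAt m x)
      · convert isClosed_mirrorUnion m (mirrorsAt m x)ᶜ using 1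
        ext y
        simp [hmem, hz]
      · convert isClosed_univ using 1
        ext y
        simp [hmem, hz]
    have hxV : x ∉ mirrorUnion m (mirrorsAt m x)ᶜ := by
      intro h
      simp only [mirrorUnion, mem_iUnion] at h
      obtain ⟨s, hs, h⟩ := h
      exact hs h
    refine ⟨N w, N w', hopen w, hopen w', (hmem _ _ _).2 ⟨by simp [one_mem], hxV⟩,
      (hmem _ _ _).2 ⟨by simp [one_mem], hxV⟩, disjoint_left.2 fun u hu hu' => huv ?_⟩
    obtain ⟨z, y, rfl⟩ := exists_mk cs m u
    refine (mk_eq_mk cs m).2 ⟨rfl, ?_⟩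
    have := mul_mem ((hmem _ _ _).1 hu).1 (inv_mem ((hmem _ _ _).1 hu').1)
    simpa [mul_assoc] using this
  · obtain ⟨A, B, hA, hB, hxA, hxB, hAB⟩ := t2_separation hx
    exact ⟨proj cs m ⁻¹' A, proj cs m ⁻¹' B, hA.preimage (continuous_proj cs m),
      hB.preimage (continuous_proj cs m), hxA, hxB, hAB.preimage _⟩

variable {cs m} in
theorem charMap_coe [T2Space X] {n : ℕ} {c : cell (univ : Set X) n} (w : W) {y : Fin n → ℝ}
    (hy : y ∈ closedBall 0 1) :
    charMap cs m n ⟨c, QuotientGroup.mk w⟩ y = mk cs m w (map n c y) := by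
  obtain ⟨h, hh⟩ := QuotientGroup.mk_out_eq_mul (special cs (mirrorsOf m n c)) w
  refine (mk_eq_mk cs m).2 ⟨rfl, ?_⟩
  have := special_mono cs (mirrorsOf_subset (m := m) (mem_image_of_mem _ hy :
    map n c y ∈ closedCell n c))
  rw [hh]
  simpa using this h.2

/-- The CW structure of `𝒰(W, X)`. -/
instance [T2Space X] : CWComplex (univ : Set (BasicConstruction cs m)) where
  cell := Cell cs m
  map := charMap cs m
  source_eq _ _ := rfl
  continuousOn n e := (continuous_mk cs m _).comp_continuousOn (continuousOn n e.1)
  continuousOn_symm n e := by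
    refine (continuousOn_symm n e.1).comp (continuous_proj cs m).continuousOn ?_
    rintro _ ⟨x, hx, rfl⟩
    rw [proj_mk, ← (map n e.1).image_source_eq_target, source_eq n e.1]
    exact hx
  pairwiseDisjoint' := by
    rintro ⟨n, c, v⟩ - ⟨k, d, w⟩ - hne
    refine disjoint_left.2 ?_
    rintro _ ⟨y, hy, rfl⟩ ⟨z, hz, hzy⟩
    refine hne ?_
    obtain ⟨h1, h2⟩ := (mk_eq_mk cs m).1 hzy
    have hyc : map n c y ∈ openCell n c := mem_image_of_mem _ hy
    have hzd : map k d z ∈ openCell k d := mem_image_of_mem _ hz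
    have e : (⟨n, c⟩ : Σ n, cell (univ : Set X) n) = ⟨k, d⟩ := by
      by_contra hcd
      refine disjoint_left.1 (disjoint_openCell_of_ne hcd) hyc ?_
      rw [← h1]
      exact hzd
    cases e
    rw [mirrorsAt_eq hzd] at h2
    have : w = v := by
      rw [← w.out_eq', ← v.out_eq']
      exact QuotientGroup.eq.2 h2
    rw [this]
  mapsTo' n e := by
    classical
    obtain ⟨c, w⟩ := e
    obtain ⟨J, hJ⟩ := CWComplex.mapsTo (C := (univ : Set X)) n c
    refine ⟨fun k => (J k).image fun j => ⟨j, QuotientGroup.mk w.out⟩, fun y hy => ?_⟩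
    have := hJ hy
    simp only [mem_iUnion] at this ⊢
    obtain ⟨k, hk, j, hj, z, hz, hzy⟩ := this
    refine ⟨k, hk, ⟨j, QuotientGroup.mk w.out⟩, Finset.mem_image_of_mem _ hj, z, hz, ?_⟩
    rw [charMap_coe _ hz, hzy]
    rfl
  closed' A _ hA := by
    refine (isClosed_iff cs m).2 fun w => ?_
    refine (CWComplex.closed (univ : Set X) _ (subset_univ _)).2 fun n c => ?_
    convert ((isClosed_iff cs m).1 (hA n ⟨c, QuotientGroup.mk w⟩) w).inter
      (isClosed_closedCell (C := (univ : Set X)) (n := n) (i := c)) using 1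
    ext x
    simp only [mem_inter_iff, mem_preimage]
    constructor
    · rintro ⟨h, hx⟩
      refine ⟨⟨h, ?_⟩, hx⟩
      obtain ⟨y, hy, rfl⟩ := hx
      exact ⟨y, hy, charMap_coe w hy⟩
    · rintro ⟨⟨h, -⟩, hx⟩
      exact ⟨h, hx⟩
  union' := by
    refine eq_univ_of_forall fun u => ?_
    obtain ⟨w, x, rfl⟩ := exists_mk cs m u
    have hx : x ∈ ⋃ (n : ℕ) (j : cell (univ : Set X) n), closedCell n j := by
      rw [CWComplex.union]
      trivial
    simp only [mem_iUnion] at hx ⊢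
    obtain ⟨n, c, y, hy, rfl⟩ := hx
    exact ⟨n, ⟨c, QuotientGroup.mk w⟩, y, hy, charMap_coe w hy⟩

end BasicConstruction

end CoxeterDavis

end

/-! A cell of 𝒰(W, X) is a cell c of X together with a coset w W_{S(c)}, and incidence numbers
inside a translate wX are those of X (`incidence_mk`). The argument therefore stays on the level of
cellular chains and cochains: each complex of 𝒰 splits as a direct sum, indexed by w ∈ W, of
relative complexes of X.

Homology: for each w send a chain x of X to the sum of (-1)^{l(u)} wu x over u ∈ W_{In(w)}, a finite
sum because In(w) is spherical. Cells in X^{In(w)} are killed, their translates cancelling in pairs.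
The other pairs (w, c) have In(w) ∩ S(c) = ∅, which says that w is shortest in w W_{S(c)}, so they
correspond to the cells of 𝒰. Since w is longest in w W_{In(w)}, the resulting matrix is
unitriangular for the length of w, and C(𝒰) is the sum of the complexes C(X)/C(X^{In(w)})
(`surjective_lsum_alternatingTranslate`, `mem_chainsIn_of_lsum_alternatingTranslate_eq_zero`).

Cohomology: extend a cochain of (X, X^{S-In(w)}) constantly along w W_{In(w)} and by zero elsewhere.
The relevant pairs now satisfy S(c) ⊆ In(w), so w is longest in w W_{S(c)}; such a w exists because
S(c) is spherical. Compactness leaves finitely many cells in X, and unitriangularity again gives the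
splitting (`exists_lsum_cosetExtend_eq`, `eq_zero_of_lsum_cosetExtend_eq_zero`).

Sorting the sums over w by T = In(w) produces the tensor factors, since the elements spanning Ĥ^T
and Â^T are independent by the same triangularity; for Â^T, w is replaced by its inverse. All length
statements rest on the exchange condition, which comes from an action of W on W × ZMod 2 recording
parities of inversions. -/

noncomputable section

/-! ### The exchange condition -/

namespace CoxeterSystem

variable {S : Type*} {M : CoxeterMatrix S} {W : Type*} [Group W] (cs : CoxeterSystem M W)

open scoped Classical in
/-- The involution `(t, ε) ↦ (s t s, ε + [t = s])` of `W × ZMod 2`. -/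
def inversionPerm (i : S) : Equiv.Perm (W × ZMod 2) :=
  Function.Involutive.toPerm
    (fun p => (cs.simple i * p.1 * cs.simple i, p.2 + if p.1 = cs.simple i then 1 else 0)) (by
      rintro ⟨t, ε⟩
      have h : cs.simple i * t * cs.simple i = cs.simple i ↔ t = cs.simple i := by
        constructor
        · intro h
          have := congrArg (fun x => cs.simple i * x * cs.simple i) h
          simpa [mul_assoc] using this
        · rintro rfl
          simp
      ext
      · simp [mul_assoc]
      · simp only [h, add_assoc, CharTwo.add_self_eq_zero, add_zero])

open scoped Classical in
theorem inversionPerm_apply (i : S) (t : W) (ε : ZMod 2) :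
    cs.inversionPerm i (t, ε) =
      (cs.simple i * t * cs.simple i, ε + if t = cs.simple i then 1 else 0) := rfl

-- Each factor `s_i s_j` tests the current conjugate of `t` against `s_j` and then, after
-- conjugation by `s_j`, against `s_i`. Pulled back to `t` itself, the tests at stage `k` are for
-- the exponents `2k` and `2k + 1`.
open scoped Classical in
theorem inversionPerm_mul_pow_apply (i j : S) (k : ℕ) (t : W) (ε : ZMod 2) :
    ((cs.inversionPerm i * cs.inversionPerm j) ^ k) (t, ε) =
      ((cs.simple i * cs.simple j) ^ k * t * ((cs.simple i * cs.simple j) ^ k)⁻¹,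
        ε + ∑ a ∈ Finset.range (2 * k),
          if t = cs.simple j * (cs.simple i * cs.simple j) ^ a then 1 else 0) := by
  induction k with
  | zero => simp
  | succ k ih =>
    -- The dihedral relation: conjugation by `s_j` inverts `s_i s_j`.
    have hconj : ((cs.simple i * cs.simple j) ^ k)⁻¹ * cs.simple j =
        cs.simple j * (cs.simple i * cs.simple j) ^ k := by
      have h : SemiconjBy (cs.simple j) (cs.simple i * cs.simple j)
          (cs.simple i * cs.simple j)⁻¹ := by
        simp [SemiconjBy, mul_assoc]
      have := (h.pow_right k).eq
      rw [inv_pow] at this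
      exact this.symm
    set ρ := cs.simple i * cs.simple j with hρ
    have h1 : ρ ^ k * t * (ρ ^ k)⁻¹ = cs.simple j ↔ t = cs.simple j * ρ ^ (2 * k) := by
      rw [mul_inv_eq_iff_eq_mul, ← eq_inv_mul_iff_mul_eq, ← mul_assoc, hconj, mul_assoc, ← pow_add,
        two_mul]
    have h2 : cs.simple j * (ρ ^ k * t * (ρ ^ k)⁻¹) * cs.simple j = cs.simple i ↔
        t = cs.simple j * ρ ^ (2 * k + 1) := by
      have e : cs.simple j * (ρ ^ k * t * (ρ ^ k)⁻¹) * cs.simple j = cs.simple i ↔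
          ρ ^ k * t * (ρ ^ k)⁻¹ = cs.simple j * ρ := by
        constructor
        · intro h
          have := congrArg (fun x => cs.simple j * x * cs.simple j) h
          simpa [mul_assoc, hρ] using this
        · intro h
          rw [h]
          simp [hρ, mul_assoc]
      rw [e, mul_inv_eq_iff_eq_mul, ← eq_inv_mul_iff_mul_eq, ← mul_assoc, ← mul_assoc, hconj]
      rw [mul_assoc, mul_assoc, ← pow_succ', ← pow_add]
      ring_nf
    rw [pow_succ', Equiv.Perm.mul_apply, ih, Equiv.Perm.mul_apply, inversionPerm_apply,
      inversionPerm_apply]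
    ext
    · simp [pow_succ', hρ, mul_assoc]
    · simp only [h1, h2, Nat.mul_succ, Finset.sum_range_succ, add_assoc]

/-- As `(s_i s_j) ^ M i j = 1`, the `2 * M i j` tests are `M i j` tests each made twice, which
cancel modulo 2. For `M i j = 0` there is nothing to test. -/
theorem isLiftable_inversionPerm : M.IsLiftable cs.inversionPerm := by
  classical
  intro i j
  ext1 ⟨t, ε⟩
  rw [inversionPerm_mul_pow_apply, simple_mul_simple_pow, two_mul, Finset.sum_range_add]
  simp only [pow_add, simple_mul_simple_pow, one_mul, CharTwo.add_self_eq_zero]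
  simp

/-- The action of `W` on `W × ZMod 2` which records parities of inversions. -/
def inversionHom : W →* Equiv.Perm (W × ZMod 2) :=
  cs.lift ⟨cs.inversionPerm, cs.isLiftable_inversionPerm⟩

-- The left side depends only on the product of the word. Hence so does the parity of the number of
-- occurrences of `t` in the inversion sequence.
open scoped Classical in
theorem inversionHom_wordProd (ω : List S) (t : W) (ε : ZMod 2) :
    cs.inversionHom (cs.wordProd ω) (t, ε) =
      (cs.wordProd ω * t * (cs.wordProd ω)⁻¹, ε + ((cs.rightInvSeq ω).count t : ℕ)) := by
  induction ω with
  | nil => simp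
  | cons i ω ih =>
    have h : cs.inversionHom (cs.simple i) = cs.inversionPerm i := cs.lift_apply_simple _ i
    rw [wordProd_cons, map_mul, Equiv.Perm.mul_apply, ih, h, inversionPerm_apply]
    have e : cs.wordProd ω * t * (cs.wordProd ω)⁻¹ = cs.simple i ↔
        (cs.wordProd ω)⁻¹ * cs.simple i * cs.wordProd ω = t := by
      constructor
      · intro h
        rw [← h]
        group
      · intro h
        rw [← h]
        group
    ext
    · simp [mul_assoc]
    · simp only [rightInvSeq, List.count_cons, e, beq_iff_eq, add_assoc]
      push_cast
      rfl

/-- Compare `ω`, which need not be reduced, with a reduced word for the same element ending in `i`.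
There `s_i` occurs exactly once, reduced inversion sequences having no repetition, so it occurs an
odd number of times for `ω`. -/
theorem mem_rightInvSeq_of_isRightDescent {ω : List S} {i : S}
    (h : cs.IsRightDescent (cs.wordProd ω) i) : cs.simple i ∈ cs.rightInvSeq ω := by
  classical
  obtain ⟨ν, hν, hνe⟩ := cs.exists_isReduced (cs.wordProd ω * cs.simple i)
  have hprod : cs.wordProd (ν.concat i) = cs.wordProd ω := by
    rw [wordProd_concat, ← hνe]
    simp
  have hred : cs.IsReduced (ν.concat i) := by
    have h1 := cs.isRightDescent_iff.1 h
    have h2 : cs.length (cs.wordProd ω * cs.simple i) = ν.length := by rw [hνe, hν.eq]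
    rw [IsReduced, hprod, List.length_concat, ← h1, h2]
  have hmem : cs.simple i ∈ cs.rightInvSeq (ν.concat i) := by
    rw [rightInvSeq_concat]
    simp
  have hc := List.count_eq_one_of_mem hred.nodup_rightInvSeq hmem
  have e := cs.inversionHom_wordProd (ν.concat i) (cs.simple i) 0
  rw [hprod, inversionHom_wordProd, hc] at e
  have e2 := congrArg Prod.snd e
  simp only [zero_add, Nat.cast_one] at e2
  by_contra hn
  rw [List.count_eq_zero_of_not_mem hn] at e2
  simp at e2

/-- The exchange condition. -/
theorem exists_eraseIdx_of_isRightDescent {ω : List S} {i : S}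
    (h : cs.IsRightDescent (cs.wordProd ω) i) :
    ∃ j < ω.length, cs.wordProd ω * cs.simple i = cs.wordProd (ω.eraseIdx j) := by
  obtain ⟨j, hj, e⟩ := List.mem_iff_getElem.1 (cs.mem_rightInvSeq_of_isRightDescent h)
  have hj' : j < ω.length := by simpa using hj
  refine ⟨j, hj', ?_⟩
  -- Multiplying by the `j`-th entry of the right inversion sequence erases the `j`-th letter.
  rw [← wordProd_mul_getD_rightInvSeq, List.getD_eq_getElem _ _ hj, e]

theorem finite_rightDescent (w : W) : {t | ∃ i, cs.IsRightDescent w i ∧ cs.simple i = t}.Finite := by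
  obtain ⟨ω, -, rfl⟩ := cs.exists_isReduced w
  refine (cs.rightInvSeq ω).finite_toSet.subset ?_
  rintro _ ⟨i, hi, rfl⟩
  exact cs.mem_rightInvSeq_of_isRightDescent hi

/-- The deletion property: appending a letter to a reduced word either keeps it reduced or, by
exchange, amounts to erasing an earlier letter. Being a sublist matters because no letter outside a
given `T` is introduced. -/
theorem exists_isReduced_sublist (ω : List S) :
    ∃ ν, ν.Sublist ω ∧ cs.IsReduced ν ∧ cs.wordProd ν = cs.wordProd ω := by
  induction ω using List.reverseRecOn with
  | nil => exact ⟨[], by simp, by simp [IsReduced], rfl⟩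
  | append_singleton ω i ih =>
    obtain ⟨ν, hs, hr, he⟩ := ih
    by_cases h : cs.IsRightDescent (cs.wordProd ν) i
    · obtain ⟨j, hj, e⟩ := cs.exists_eraseIdx_of_isRightDescent h
      refine ⟨ν.eraseIdx j, ((ν.eraseIdx_sublist j).trans hs).trans (by simp), ?_, ?_⟩
      · have h1 := cs.isRightDescent_iff.1 h
        rw [hr.eq] at h1
        rw [IsReduced, ← e, List.length_eraseIdx_of_lt hj]
        lia
      · rw [← e, wordProd_append, he]
        simp
    · refine ⟨ν ++ [i], hs.append (List.Sublist.refl _), ?_, by simp [wordProd_append, he]⟩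
      have h1 := cs.not_isRightDescent_iff.1 h
      rw [IsReduced, wordProd_append, wordProd_singleton, h1, hr.eq]
      simp

end CoxeterSystem

/-! ### Extremal elements of cosets of special subgroups -/

namespace CoxeterDavis

variable {S : Type*} {M : CoxeterMatrix S} {W : Type*} [Group W] (cs : CoxeterSystem M W)

theorem simple_mem_special {T : Set S} {s : S} (hs : s ∈ T) : cs.simple s ∈ special cs T :=
  Subgroup.subset_closure (mem_image_of_mem _ hs)

theorem exists_isReduced_of_mem_special {T : Set S} {u : W} (hu : u ∈ special cs T) :
    ∃ ω : List S, (∀ s ∈ ω, s ∈ T) ∧ cs.IsReduced ω ∧ cs.wordProd ω = u := by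
  have key : ∃ ω : List S, (∀ s ∈ ω, s ∈ T) ∧ cs.wordProd ω = u := by
    induction hu using Subgroup.closure_induction with
    | mem x hx =>
      obtain ⟨s, hs, rfl⟩ := hx
      exact ⟨[s], by simpa using hs, by simp⟩
    | one => exact ⟨[], by simp, by simp⟩
    | mul x y _ _ hx hy =>
      obtain ⟨ω, h, rfl⟩ := hx
      obtain ⟨ν, h', rfl⟩ := hy
      refine ⟨ω ++ ν, fun s hs => ?_, cs.wordProd_append _ _⟩
      rcases List.mem_append.1 hs with hs | hs
      exacts [h s hs, h' s hs]
    | inv x _ hx =>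
      obtain ⟨ω, h, rfl⟩ := hx
      exact ⟨ω.reverse, fun s hs => h s (List.mem_reverse.1 hs), cs.wordProd_reverse _⟩
  obtain ⟨ω, h, rfl⟩ := key
  obtain ⟨ν, hs, hr, he⟩ := cs.exists_isReduced_sublist ω
  exact ⟨ν, fun s hsν => h s (hs.subset hsν), hr, he⟩

theorem wordProd_mem_special {T : Set S} {ω : List S} (h : ∀ s ∈ ω, s ∈ T) :
    cs.wordProd ω ∈ special cs T := by
  induction ω with
  | nil => simp [one_mem]
  | cons i ω ih =>
    rw [cs.wordProd_cons]
    exact mul_mem (simple_mem_special cs (h i (by simp))) (ih fun s hs => h s (by simp [hs]))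

/-- Lengths add up in a coset of `W_T` with respect to an element of minimal length. -/
theorem length_mul_of_minimal {T : Set S} {w : W}
    (hw : ∀ u ∈ special cs T, cs.length w ≤ cs.length (w * u)) {u : W} (hu : u ∈ special cs T) :
    cs.length (w * u) = cs.length w + cs.length u := by
  obtain ⟨ω, hT, hr, rfl⟩ := exists_isReduced_of_mem_special cs hu
  clear hu
  induction ω using List.reverseRecOn with
  | nil => simp
  | append_singleton ω s ih =>
    have hrω : cs.IsReduced ω := by simpa using hr.take ω.length
    have hTω : ∀ s ∈ ω, s ∈ T := fun t ht => hT t (by simp [ht])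
    have ih := ih hTω hrω
    have hsT : s ∈ T := hT s (by simp)
    rw [hr.eq, cs.wordProd_append, cs.wordProd_singleton, List.length_append, List.length_singleton,
      ← mul_assoc]
    rw [hrω.eq] at ih
    -- Otherwise exchange erases a letter of `ν ++ ω`. If it lies in `ν`, the coset has an element
    -- shorter than `w`; if it lies in `ω`, then `ω ++ [s]` is not reduced.
    have hnd : ¬ cs.IsRightDescent (w * cs.wordProd ω) s := by
      intro hd
      obtain ⟨ν, hν, rfl⟩ := cs.exists_isReduced w
      rw [← cs.wordProd_append] at hd
      obtain ⟨j, hj, e⟩ := cs.exists_eraseIdx_of_isRightDescent hd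
      rw [cs.wordProd_append] at e
      rcases lt_or_ge j ν.length with hjν | hjν
      · rw [List.eraseIdx_append_of_lt_length hjν, cs.wordProd_append] at e
        have hmem : cs.wordProd ω * cs.simple s * (cs.wordProd ω)⁻¹ ∈ special cs T :=
          mul_mem (mul_mem (wordProd_mem_special cs hTω) (simple_mem_special cs hsT))
            (inv_mem (wordProd_mem_special cs hTω))
        have h1 := hw _ hmem
        have h2 : cs.wordProd ν * (cs.wordProd ω * cs.simple s * (cs.wordProd ω)⁻¹) =
            cs.wordProd (ν.eraseIdx j) := by
          rw [← mul_assoc, ← mul_assoc, e]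
          simp
        rw [h2, hν.eq] at h1
        have h3 := cs.length_wordProd_le (ν.eraseIdx j)
        rw [List.length_eraseIdx_of_lt hjν] at h3
        lia
      · rw [List.eraseIdx_append_of_length_le hjν, cs.wordProd_append, mul_assoc] at e
        have e := mul_left_cancel e
        have h1 := hr.eq
        rw [cs.wordProd_append, cs.wordProd_singleton, e] at h1
        have h3 := cs.length_wordProd_le (ω.eraseIdx (j - ν.length))
        rw [List.length_append] at hj
        rw [List.length_eraseIdx_of_lt (by lia)] at h3
        simp at h1
        lia
    rw [cs.not_isRightDescent_iff.1 hnd, ih]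
    ring

/-- If all `s ∈ T` are right descents of `w`, then `w` is the longest element of `w W_T`. -/
theorem length_mul_add_of_subset_rightIn {T : Set S} {w : W} (hw : T ⊆ rightIn cs w) {u : W}
    (hu : u ∈ special cs T) : cs.length (w * u) + cs.length u = cs.length w := by
  -- With a word for `u⁻¹`, the induction exhibits `ω` as a suffix of a reduced word for `w`. The
  -- new letter `s` is then always tested as a descent of `w` itself, the only element whose
  -- descents are known.
  suffices key : ∀ ω : List S, (∀ s ∈ ω, s ∈ T) → cs.IsReduced ω →
      cs.length (w * (cs.wordProd ω)⁻¹) + ω.length = cs.length w by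
    obtain ⟨ω, hT, hr, e⟩ := exists_isReduced_of_mem_special cs (inv_mem hu)
    have := key ω hT hr
    rwa [← hr.eq, e, inv_inv, cs.length_inv] at this
  intro ω hT hr
  induction ω using List.reverseRecOn with
  | nil => simp
  | append_singleton ω s ih =>
    have hrω : cs.IsReduced ω := by simpa using hr.take ω.length
    have ih := ih (fun t ht => hT t (by simp [ht])) hrω
    have hsT : s ∈ T := hT s (by simp)
    obtain ⟨ν, hν, hνe⟩ := cs.exists_isReduced (w * (cs.wordProd ω)⁻¹)
    have hwe : cs.wordProd (ν ++ ω) = w := by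
      rw [cs.wordProd_append, ← hνe]
      simp
    have hd : cs.IsRightDescent (cs.wordProd (ν ++ ω)) s := by
      rw [hwe]
      exact hw hsT
    obtain ⟨j, hj, e⟩ := cs.exists_eraseIdx_of_isRightDescent hd
    rw [hνe, hν.eq] at ih
    have hlow := cs.length_le_length_mul_add_right w (cs.wordProd (ω ++ [s]))⁻¹
    rw [cs.length_inv, hr.eq] at hlow
    -- Erasing a letter of `ν` gives the next drop in length, sharp by `hlow`; erasing one of `ω`
    -- would contradict that `ω ++ [s]` is reduced.
    rcases lt_or_ge j ν.length with hjν | hjν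
    · rw [List.eraseIdx_append_of_lt_length hjν, hwe, cs.wordProd_append] at e
      have h2 : w * (cs.wordProd (ω ++ [s]))⁻¹ = cs.wordProd (ν.eraseIdx j) := by
        rw [cs.wordProd_append, cs.wordProd_singleton, mul_inv_rev, cs.inv_simple, ← mul_assoc, e]
        simp
      have h3 := cs.length_wordProd_le (ν.eraseIdx j)
      rw [List.length_eraseIdx_of_lt hjν] at h3
      rw [h2] at hlow ⊢
      simp at hlow ⊢
      lia
    · rw [List.eraseIdx_append_of_length_le hjν, cs.wordProd_append, cs.wordProd_append,
        mul_assoc] at e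
      have e := mul_left_cancel e
      have h1 := hr.eq
      rw [cs.wordProd_append, cs.wordProd_singleton, e] at h1
      have h3 := cs.length_wordProd_le (ω.eraseIdx (j - ν.length))
      rw [List.length_append] at hj
      rw [List.length_eraseIdx_of_lt (by lia)] at h3
      simp at h1
      lia

theorem rightIn_inv (w : W) : rightIn cs w⁻¹ = leftIn cs w := by
  ext s
  have : w⁻¹ * cs.simple s = (cs.simple s * w)⁻¹ := by simp
  simp only [rightIn, leftIn, mem_ofPred_eq, this, cs.length_inv]

theorem leftIn_inv (w : W) : leftIn cs w⁻¹ = rightIn cs w := by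
  rw [← rightIn_inv, inv_inv]

/-- `In(w)` is spherical. -/
theorem isSpherical_rightIn (w : W) : IsSpherical cs (rightIn cs w) := by
  have hD : (cs.simple '' rightIn cs w).Finite := by
    refine (cs.finite_rightDescent w).subset ?_
    rintro _ ⟨s, hs, rfl⟩
    exact ⟨s, hs, rfl⟩
  -- Elements of `W_{In(w)}` have length at most `l(w)`, so words of bounded length in a finite
  -- alphabet of reflections suffice.
  have hfin : {l : List W | (∀ t ∈ l, t ∈ cs.simple '' rightIn cs w) ∧
      l.length ≤ cs.length w}.Finite := by
    have : Finite (cs.simple '' rightIn cs w) := hD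
    refine ((List.finite_length_le (cs.simple '' rightIn cs w) (cs.length w)).image
      (List.map Subtype.val)).subset ?_
    rintro l ⟨h, hl⟩
    exact ⟨l.attachWith _ h, by simpa using hl, by simp⟩
  refine Set.Finite.subset (hfin.image List.prod) ?_
  intro u hu
  obtain ⟨ω, hT, hr, rfl⟩ := exists_isReduced_of_mem_special cs hu
  refine ⟨ω.map cs.simple, ⟨?_, ?_⟩, rfl⟩
  · intro t ht
    obtain ⟨s, hs, rfl⟩ := List.mem_map.1 ht
    exact mem_image_of_mem _ (hT s hs)
  · have := length_mul_add_of_subset_rightIn cs (Subset.refl _) hu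
    rw [hr.eq] at this
    rw [List.length_map]
    lia

/-- The source of every triangularity argument below: off the diagonal, the length strictly drops.
-/
theorem length_lt_of_mem_special_rightIn {T : Set S} {w u : W} (hw : T ⊆ rightIn cs w)
    (hu : u ∈ special cs T) (h1 : u ≠ 1) : cs.length (w * u) < cs.length w := by
  have := length_mul_add_of_subset_rightIn cs hw hu
  have h2 := cs.length_eq_zero_iff.not.2 h1
  lia

/-- A longest element of the coset works, and exists because the coset is finite. This is where the
cohomological half needs spherical stabilizers; the homological half uses shortest elements, which
always exist. -/
theorem exists_subset_rightIn {T : Set S} (hT : IsSpherical cs T) (w : W) :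
    ∃ u ∈ special cs T, T ⊆ rightIn cs (w * u) := by
  have : Finite (special cs T) := hT
  obtain ⟨u, hu⟩ := Finite.exists_max fun u : special cs T => cs.length (w * u)
  refine ⟨u, u.2, fun s hs => ?_⟩
  have h1 := hu ⟨_, mul_mem u.2 (simple_mem_special cs hs)⟩
  refine lt_of_le_of_ne ?_ (cs.length_mul_simple_ne _ s)
  simpa [mul_assoc] using h1

theorem exists_minimal (T : Set S) (w : W) :
    ∃ u ∈ special cs T, ∀ v ∈ special cs T, cs.length (w * u) ≤ cs.length (w * u * v) := by
  let u : special cs T := Function.argmin fun u : special cs T => cs.length (w * u)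
  refine ⟨u, u.2, fun v hv => ?_⟩
  rw [mul_assoc]
  exact Function.argmin_le (fun u : special cs T => cs.length (w * u)) ⟨_, mul_mem u.2 hv⟩

theorem exists_disjoint_rightIn (T : Set S) (w : W) :
    ∃ u ∈ special cs T, Disjoint (rightIn cs (w * u)) T := by
  obtain ⟨u, hu, h⟩ := exists_minimal cs T w
  exact ⟨u, hu, disjoint_left.2 fun s hs hsT =>
    (h _ (simple_mem_special cs hsT)).not_gt hs⟩

/-- If no `s ∈ T` is a right descent of `w`, then `w` is the shortest element of `w W_T`. -/
theorem length_mul_of_disjoint_rightIn {T : Set S} {w : W} (hw : Disjoint (rightIn cs w) T) {u : W}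
    (hu : u ∈ special cs T) : cs.length (w * u) = cs.length w + cs.length u := by
  refine length_mul_of_minimal cs ?_ hu
  obtain ⟨x, hx, h⟩ := exists_minimal cs T w
  obtain ⟨ω, hT, hr, hω⟩ := exists_isReduced_of_mem_special cs (inv_mem hx)
  -- Here `w * x` is minimal in the coset and `w = (w * x) * x⁻¹` with lengths adding. A last letter
  -- `s` of a reduced word for `x⁻¹` would be a right descent of `w` lying in `T`.
  rcases List.eq_nil_or_concat' ω with rfl | ⟨ν, s, rfl⟩
  · have : x = 1 := by simpa [eq_comm] using hω
    simpa [this] using h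
  · have hs : s ∈ T := hT s (by simp)
    have hν : cs.IsReduced ν := by simpa using hr.take ν.length
    have h1 := length_mul_of_minimal cs h (inv_mem hx)
    have hsν : x⁻¹ * cs.simple s = cs.wordProd ν := by
      rw [← hω]
      simp [cs.wordProd_append]
    have h2 := length_mul_of_minimal cs h (mul_mem (inv_mem hx) (simple_mem_special cs hs))
    rw [hsν, hν.eq, ← hsν] at h2
    rw [← hω, hr.eq, hω] at h1
    simp only [mul_inv_cancel_right, ← mul_assoc] at h1 h2
    refine absurd (?_ : s ∈ rightIn cs w) (disjoint_right.1 hw hs)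
    simp only [rightIn, mem_ofPred_eq]
    rw [h1, h2]
    simp

theorem eq_of_disjoint_rightIn {T : Set S} {w w' : W} (hw : Disjoint (rightIn cs w) T)
    (hw' : Disjoint (rightIn cs w') T) (h : w⁻¹ * w' ∈ special cs T) : w = w' := by
  have h1 := length_mul_of_disjoint_rightIn cs hw h
  have h2 := length_mul_of_disjoint_rightIn cs hw' (inv_mem h)
  simp only [mul_inv_cancel_left, mul_inv_rev, inv_inv] at h1 h2
  have h3 : w'⁻¹ * w = (w⁻¹ * w')⁻¹ := by simp
  rw [h3, cs.length_inv] at h2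
  rw [← inv_mul_eq_one, ← cs.length_eq_zero_iff]
  lia

end CoxeterDavis

/-! ### Cells of a compact CW complex -/

namespace CellularHomology

open RelCWComplex

variable {X : Type*} [TopologicalSpace X]

/-- A compact CW complex has finitely many cells. -/
theorem finite_cell [T2Space X] [CompactSpace X] [CWComplex (univ : Set X)] (n : ℕ) :
    Finite (cell (univ : Set X) n) := by
  choose p hp using openCell_nonempty (C := (univ : Set X)) n
  have hinj : Function.Injective p := by
    intro c d h
    by_contra hne
    refine disjoint_left.1 (disjoint_openCell_of_ne (C := (univ : Set X)) (n := n) (m := n)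
      (i := c) (j := d) ?_) (hp c) (h ▸ hp d)
    rintro ⟨⟩
    exact hne rfl
  -- A closed cell meets only finitely many open cells, so any set with at most one point in each
  -- open `n`-cell is closed. Thus `range p` is closed and discrete in a compact space.
  have hclosed : ∀ A : Set X, A ⊆ range p → IsClosed A := by
    intro A hA
    refine (CWComplex.closed (univ : Set X) _ (subset_univ _)).2 fun k d => ?_
    obtain ⟨I, hI⟩ := CWComplex.cellFrontier_subset_finite_openCell (C := (univ : Set X)) k d
    refine Set.Finite.isClosed ?_
    have hfin : {c : cell (univ : Set X) n | c ∈ I n ∨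
        (⟨n, c⟩ : Σ n, cell (univ : Set X) n) = ⟨k, d⟩}.Finite := by
      refine (I n).finite_toSet.union (Set.Subsingleton.finite ?_)
      rintro c hc c' hc'
      have := (mem_ofPred.1 hc).trans (mem_ofPred.1 hc').symm
      simpa using this
    refine (hfin.image p).subset ?_
    rintro x ⟨hx, hxd⟩
    obtain ⟨c, rfl⟩ := hA hx
    refine mem_image_of_mem _ ?_
    by_contra hn
    simp only [mem_ofPred_eq, not_or] at hn
    rw [← cellFrontier_union_openCell_eq_closedCell] at hxd
    rcases hxd with hxd | hxd
    · have := hI hxd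
      simp only [mem_iUnion] at this
      obtain ⟨l, -, j, hj, hxj⟩ := this
      refine disjoint_left.1 (disjoint_openCell_of_ne (C := (univ : Set X)) (n := n) (m := l)
        (i := c) (j := j) ?_) (hp c) hxj
      rintro ⟨⟩
      exact hn.1 hj
    · exact disjoint_left.1 (disjoint_openCell_of_ne hn.2) (hp c) hxd
  have hd : DiscreteTopology (range p) := by
    refine discreteTopology_iff_forall_isClosed.2 fun s => ?_
    have := (hclosed (Subtype.val '' s) (by rintro _ ⟨x, -, rfl⟩; exact x.2)).preimage
      (continuous_subtype_val (p := (· ∈ range p)))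
    rwa [preimage_image_eq _ Subtype.val_injective] at this
  have hf : (range p).Finite :=
    (hclosed _ Subset.rfl).isCompact.finite ⟨hd⟩
  have : Finite (range p) := hf
  exact Finite.of_injective (rangeFactorization p) fun c d h => hinj (congrArg Subtype.val h)

end CellularHomology

/-! ### Cellular chains and cochains of the basic construction -/

namespace CoxeterDavis

open RelCWComplex CellularHomology BasicConstruction

variable {S : Type*} {M : CoxeterMatrix S} {W : Type*} [Group W] (cs : CoxeterSystem M W)
  {X : Type*} [TopologicalSpace X] [T2Space X] [CWComplex (univ : Set X)] (m : Mirrors S X)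

theorem mk_mem_openCell_iff {n : ℕ} {c : cell (univ : Set X) n}
    {κ : W ⧸ special cs (mirrorsOf m n c)} {w : W} {x : X} :
    mk cs m w x ∈ openCell (C := (univ : Set (BasicConstruction cs m))) n (⟨c, κ⟩ : Cell cs m n) ↔
      x ∈ openCell n c ∧ κ = QuotientGroup.mk w := by
  constructor
  · rintro ⟨y, hy, h⟩
    obtain ⟨rfl, h2⟩ := (mk_eq_mk cs m).1 h
    have hy' : map n c y ∈ openCell n c := mem_image_of_mem _ hy
    refine ⟨hy', ?_⟩
    rw [mirrorsAt_eq hy'] at h2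
    rw [← κ.out_eq']
    exact QuotientGroup.eq.2 h2
  · rintro ⟨⟨y, hy, rfl⟩, rfl⟩
    exact ⟨y, hy, charMap_coe w (ball_subset_closedBall hy)⟩

/-- The two attaching maps followed by the collapses are the same map of spheres, so no degree has
to be computed. -/
theorem incidence_mk {n : ℕ} (c : cell (univ : Set X) (n + 1)) (c' : cell (univ : Set X) n) (w : W) :
    incidence (univ : Set (BasicConstruction cs m)) n
      (⟨c, QuotientGroup.mk w⟩ : Cell cs m (n + 1)) (⟨c', QuotientGroup.mk w⟩ : Cell cs m n) =
    incidence (univ : Set X) n c c' := by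
  unfold incidence
  congr 1
  ext1 x
  change collapse (univ : Set (BasicConstruction cs m)) n (⟨c', QuotientGroup.mk w⟩ : Cell cs m n)
    (charMap cs m (n + 1) ⟨c, QuotientGroup.mk w⟩ x.1) = collapse _ n c' (map (n + 1) c x.1)
  rw [charMap_coe w (sphere_subset_closedBall x.2)]
  unfold collapse
  by_cases h : map (n + 1) c x.1 ∈ openCell n c'
  · rw [dif_pos h, dif_pos ((mk_mem_openCell_iff cs m).2 ⟨h, rfl⟩)]
    rfl
  · rw [dif_neg h, dif_neg fun h' => h ((mk_mem_openCell_iff cs m).1 h').1]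

theorem incidence_mk_of_ne {n : ℕ} (c : cell (univ : Set X) (n + 1)) (c' : cell (univ : Set X) n)
    (w : W) {κ : W ⧸ special cs (mirrorsOf m n c')} (hκ : κ ≠ QuotientGroup.mk w) :
    incidence (univ : Set (BasicConstruction cs m)) n
      (⟨c, QuotientGroup.mk w⟩ : Cell cs m (n + 1)) (⟨c', κ⟩ : Cell cs m n) = 0 := by
  refine incidence_eq_zero _ _ _ _ (disjoint_left.2 ?_)
  rintro _ ⟨x, hx, rfl⟩ h
  refine hκ ((mk_mem_openCell_iff cs m (x := map (n + 1) c x)).1 ?_).2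
  rw [← charMap_coe w (sphere_subset_closedBall hx)]
  exact h

variable {m}

/-- Nonzero incidence makes the frontier of `c` meet the open cell `c'`. A mirror containing `c` is
closed, so it contains a point of `c'` and hence all of `c'`. -/
theorem mirrorsOf_subset_of_incidence_ne_zero {n : ℕ} {c : cell (univ : Set X) (n + 1)}
    {c' : cell (univ : Set X) n} (h : incidence (univ : Set X) n c c' ≠ 0) :
    mirrorsOf m (n + 1) c ⊆ mirrorsOf m n c' := by
  have := mt (incidence_eq_zero _ n c c') h
  obtain ⟨x, hx, hx'⟩ := not_disjoint_iff.1 this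
  rw [← mirrorsAt_eq hx']
  exact mirrorsOf_subset (cellFrontier_subset_closedCell _ _ hx)

/-- Mirrors are unions of open cells, so one point of the cell decides which mirrors contain it; a
cell covered by several mirrors lies in one of them. -/
theorem openCell_subset_mirrorUnion_iff {n : ℕ} {c : cell (univ : Set X) n} {T : Set S} :
    openCell n c ⊆ mirrorUnion m T ↔ ¬ Disjoint T (mirrorsOf m n c) := by
  rw [not_disjoint_iff]
  constructor
  · intro h
    obtain ⟨x, hx⟩ := openCell_nonempty (C := (univ : Set X)) n c
    have := h hx
    simp only [mirrorUnion, mem_iUnion] at this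
    obtain ⟨s, hs, hxs⟩ := this
    refine ⟨s, hs, ?_⟩
    rw [← mirrorsAt_eq hx]
    exact hxs
  · rintro ⟨s, hs, hc⟩
    exact (show openCell n c ⊆ (m s : Set X) from hc).trans
      (subset_biUnion_of_mem (u := fun s => (m s : Set X)) hs)

omit [T2Space X] in
theorem isSpherical_mirrorsOf (h : ∀ U : Set S, ¬ IsSpherical cs U → mirrorInter m U = ∅) (n : ℕ)
    (c : cell (univ : Set X) n) : IsSpherical cs (mirrorsOf m n c) := by
  by_contra hn
  obtain ⟨x, hx⟩ := openCell_nonempty (C := (univ : Set X)) n c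
  have : x ∈ mirrorInter m (mirrorsOf m n c) := mem_iInter₂.2 fun s hs => hs hx
  rw [h _ hn] at this
  exact this

variable (m)

/-- The translate `wc` of the cell `c`. -/
def translateCell (w : W) (n : ℕ) (c : cell (univ : Set X) n) :
    cell (univ : Set (BasicConstruction cs m)) n :=
  (⟨c, QuotientGroup.mk w⟩ : Cell cs m n)

theorem translateCell_injective (w : W) (n : ℕ) : Function.Injective (translateCell cs m w n) :=
  fun _ _ h => congrArg (fun e : Cell cs m n => e.1) h

/-- The chain map induced by the inclusion `x ↦ [w, x]` of `X` in `𝒰(W, X)`. -/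
def translate (w : W) (n : ℕ) :
    Chains (univ : Set X) n →ₗ[ℤ] Chains (univ : Set (BasicConstruction cs m)) n :=
  Finsupp.lmapDomain ℤ ℤ (translateCell cs m w n)

theorem cellBoundary_translateCell (w : W) (n : ℕ) (c : cell (univ : Set X) (n + 1)) :
    cellBoundary (univ : Set (BasicConstruction cs m)) n (translateCell cs m w (n + 1) c) =
      Finsupp.mapDomain (translateCell cs m w n) (cellBoundary (univ : Set X) n c) := by
  ext e
  obtain ⟨c', κ⟩ : Cell cs m n := e
  by_cases h : κ = QuotientGroup.mk w
  · subst h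
    exact (incidence_mk cs m c c' w).trans
      (Finsupp.mapDomain_apply (translateCell_injective cs m w n)
        (cellBoundary (univ : Set X) n c) c').symm
  · refine (incidence_mk_of_ne cs m c c' w h).trans (Finsupp.mapDomain_of_notMem_range _ _ ?_).symm
    rintro ⟨d, hd⟩
    obtain ⟨rfl, h2⟩ := Sigma.mk.inj_iff.1 (show (⟨d, _⟩ : Cell cs m n) = ⟨c', κ⟩ from hd)
    exact h (eq_of_heq h2).symm

theorem boundary_translate (w : W) (n : ℕ) (x : Chains (univ : Set X) (n + 1)) :
    boundary (univ : Set (BasicConstruction cs m)) n (translate cs m w (n + 1) x) =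
      translate cs m w n (boundary (univ : Set X) n x) := by
  suffices h : (boundary (univ : Set (BasicConstruction cs m)) n).comp
      (translate cs m w (n + 1)) = (translate cs m w n).comp (boundary (univ : Set X) n) from
    LinearMap.congr_fun h x
  ext1 c
  ext1
  simp [translate, boundary, cellBoundary_translateCell]

/-- The cochain map induced by the inclusion `x ↦ [w, x]` of `X` in `𝒰(W, X)`. -/
def restrict (w : W) (n : ℕ) :
    Cochains (univ : Set (BasicConstruction cs m)) n →ₗ[ℤ] Cochains (univ : Set X) n :=
  LinearMap.funLeft ℤ ℤ (translateCell cs m w n)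

theorem restrict_apply (w : W) (n : ℕ) (f : Cochains (univ : Set (BasicConstruction cs m)) n)
    (c : cell (univ : Set X) n) : restrict cs m w n f c = f (translateCell cs m w n c) := rfl

theorem coboundary_apply {Y : Type*} [TopologicalSpace Y] [T2Space Y] [CWComplex (univ : Set Y)]
    (n : ℕ) (f : Cochains (univ : Set Y) n) (c : cell (univ : Set Y) (n + 1)) :
    coboundary (univ : Set Y) n f c =
      (cellBoundary (univ : Set Y) n c).sum fun c' a => a * f c' := rfl

theorem restrict_coboundary (w : W) (n : ℕ)
    (f : Cochains (univ : Set (BasicConstruction cs m)) n) :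
    restrict cs m w (n + 1) (coboundary (univ : Set (BasicConstruction cs m)) n f) =
      coboundary (univ : Set X) n (restrict cs m w n f) := by
  funext c
  rw [restrict_apply, coboundary_apply, coboundary_apply, cellBoundary_translateCell,
    Finsupp.sum_mapDomain_index (by simp) (by simp [add_mul])]
  rfl

theorem exists_translateCell {n : ℕ} (e : cell (univ : Set (BasicConstruction cs m)) n) :
    ∃ w c, translateCell cs m w n c = e := by
  obtain ⟨c, κ⟩ : Cell cs m n := e
  obtain ⟨w, rfl⟩ := QuotientGroup.mk_surjective κ
  exact ⟨w, c, rfl⟩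

theorem translateCell_eq_iff {n : ℕ} {w w' : W} {c c' : cell (univ : Set X) n} :
    translateCell cs m w n c = translateCell cs m w' n c' ↔
      c = c' ∧ w⁻¹ * w' ∈ special cs (mirrorsOf m n c) := by
  constructor
  · intro h
    obtain ⟨rfl, h2⟩ := Sigma.mk.inj_iff.1 (show (⟨c, _⟩ : Cell cs m n) = ⟨c', _⟩ from h)
    exact ⟨rfl, QuotientGroup.eq.1 (eq_of_heq h2)⟩
  · rintro ⟨rfl, h⟩
    exact congrArg (fun κ => (⟨c, κ⟩ : Cell cs m n)) (QuotientGroup.eq.2 h)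

theorem eq_of_restrict_eq {n : ℕ} {f g : Cochains (univ : Set (BasicConstruction cs m)) n}
    (h : ∀ w, restrict cs m w n f = restrict cs m w n g) : f = g := by
  funext e
  obtain ⟨w, c, rfl⟩ := exists_translateCell cs m e
  exact congrFun (h w) c

theorem coboundary_mem_relCochains (T : Set S) (n : ℕ) {f : Cochains (univ : Set X) n}
    (hf : f ∈ relCochains (univ : Set X) (mirrorUnion m T) n) :
    coboundary (univ : Set X) n f ∈ relCochains (univ : Set X) (mirrorUnion m T) (n + 1) := by
  intro c hc
  rw [coboundary_apply]
  refine Finset.sum_eq_zero fun c' hc' => ?_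
  have hne : incidence (univ : Set X) n c c' ≠ 0 := Finsupp.mem_support_iff.1 hc'
  rw [openCell_subset_mirrorUnion_iff] at hc
  beta_reduce
  rw [hf c', mul_zero]
  rw [openCell_subset_mirrorUnion_iff]
  exact fun hd => hc (hd.mono_right (mirrorsOf_subset_of_incidence_ne_zero hne))

end CoxeterDavis

/-! ### Linear algebra -/

namespace CoxeterDavis

/-! ### Integral families that are unitriangular for a rank function -/

section Unitriangular

variable {Q I : Type*} {P : Q → Prop} {i : Q → I} {ρ : Q → ℕ} {v : Q → I →₀ ℤ}

/-- A unitriangular family of vectors spans. -/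
theorem surjective_linearCombination_of_unitriangular
    (hsurj : ∀ j, ∃ q, P q ∧ i q = j)
    (h1 : ∀ q, P q → v q (i q) = 1)
    (hlt : ∀ q, P q → ∀ q', P q' → v q (i q') ≠ 0 → q' ≠ q → ρ q' < ρ q) :
    Function.Surjective (Finsupp.linearCombination ℤ v) := by
  classical
  -- Induction on the rank: apart from its leading coordinate, `v q` involves only coordinates of
  -- smaller rank.
  have key : ∀ (n : ℕ) (q : Q), P q → ρ q = n →
      Finsupp.single (i q) 1 ∈ LinearMap.range (Finsupp.linearCombination ℤ v) := by
    intro n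
    induction n using Nat.strong_induction_on with
    | _ n ih =>
      rintro q hq rfl
      have hv : v q ∈ LinearMap.range (Finsupp.linearCombination ℤ v) :=
        ⟨Finsupp.single q 1, by simp⟩
      have e : Finsupp.single (i q) 1 =
          v q - ((v q).erase (i q)).sum fun j a => a • Finsupp.single j 1 := by
        rw [eq_sub_iff_add_eq]
        conv_rhs => rw [← Finsupp.single_add_erase (i q) (v q), h1 q hq]
        congr 1
        simp
      rw [e]
      refine Submodule.sub_mem _ hv (Submodule.sum_mem _ fun j hj => Submodule.smul_mem _ _ ?_)
      rw [Finsupp.support_erase, Finset.mem_erase, Finsupp.mem_support_iff] at hj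
      obtain ⟨q', hq', rfl⟩ := hsurj j
      exact ih _ (hlt q hq q' hq' hj.2 fun h => hj.1 (by rw [h])) q' hq' rfl
  intro f
  rw [← LinearMap.mem_range, ← Finsupp.sum_single f]
  refine Submodule.sum_mem _ fun j _ => ?_
  obtain ⟨q, hq, rfl⟩ := hsurj j
  have := Submodule.smul_mem _ (f (i q)) (key _ q hq rfl)
  simpa using this

/-- A unitriangular family of vectors is linearly independent. -/
theorem eq_zero_of_linearCombination_of_unitriangular
    (h0 : ∀ q, ¬ P q → v q = 0)
    (h1 : ∀ q, P q → v q (i q) = 1)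
    (hlt : ∀ q, P q → ∀ q', P q' → v q (i q') ≠ 0 → q' ≠ q → ρ q' < ρ q)
    {x : Q →₀ ℤ} (hx : Finsupp.linearCombination ℤ v x = 0) {q : Q} (hq : P q) : x q = 0 := by
  classical
  -- Take `q` of maximal rank among the indices in the support satisfying `P`. Another contribution
  -- to the coordinate `i q` would have to come from an index of larger rank.
  by_contra hne
  obtain ⟨q, hqm, hmax⟩ := (x.support.filter P).exists_max_image ρ
    ⟨q, by simp [hne, hq]⟩
  simp only [Finset.mem_filter, Finsupp.mem_support_iff] at hqm hmax
  have h := DFunLike.congr_fun hx (i q)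
  rw [Finsupp.linearCombination_apply, Finsupp.sum, Finsupp.finsetSum_apply,
    Finset.sum_eq_single q] at h
  · simp [h1 q hqm.2, hqm.1] at h
  · intro q' hq' hqq
    by_cases hP : P q'
    · by_cases hv : v q' (i q) = 0
      · simp [hv]
      · exact absurd (hlt q' hP q hqm.2 hv hqq.symm)
          (hmax q' ⟨Finsupp.mem_support_iff.1 hq', hP⟩).not_gt
    · simp [h0 q' hP]
  · intro hn
    exact absurd (Finsupp.notMem_support_iff.1 hn) hqm.1

end Unitriangular

/-- A direct sum of subquotients `Z w / B w` of `M` is isomorphic to a subquotient `Z' / B'` of `N`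
if maps `ψ w : M → N` identify `⨁ Z w` and `⨁ B w` with `Z'` and `B'`. -/
theorem nonempty_directSum_subquotient_addEquiv {ι M N : Type*} [AddCommGroup M] [AddCommGroup N]
    (Z B : ι → Submodule ℤ M) (Z' B' : Submodule ℤ N) (ψ : ι → M →ₗ[ℤ] N)
    (hZ : ∀ w, ∀ x ∈ Z w, ψ w x ∈ Z') (hB : ∀ w, ∀ x ∈ B w, ψ w x ∈ B')
    (hsurj : ∀ z ∈ Z', ∃ x : ι →₀ M, (∀ w, x w ∈ Z w) ∧ x.sum (fun w a => ψ w a) = z)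
    (hinj : ∀ x : ι →₀ M, (∀ w, x w ∈ Z w) → x.sum (fun w a => ψ w a) ∈ B' → ∀ w, x w ∈ B w) :
    Nonempty ((Z' ⧸ B'.submoduleOf Z') ≃+ ⨁ w, Z w ⧸ (B w).submoduleOf (Z w)) := by
  classical
  let θ : ∀ w, (Z w ⧸ (B w).submoduleOf (Z w)) →ₗ[ℤ] (Z' ⧸ B'.submoduleOf Z') := fun w =>
    Submodule.mapQ _ _ ((ψ w).restrict (hZ w)) fun x hx => hB w x hx
  let Θ := DirectSum.toModule ℤ ι _ θ
  have hmem : ∀ x : ι →₀ M, (∀ w, x w ∈ Z w) → x.sum (fun w a => ψ w a) ∈ Z' := fun x hx =>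
    Submodule.sum_mem _ fun w _ => hZ w _ (hx w)
  have hΘ : ∀ (x : ι →₀ M) (hx : ∀ w, x w ∈ Z w) ,
      Θ (∑ w ∈ x.support, DirectSum.of (fun w => Z w ⧸ (B w).submoduleOf (Z w)) w
        (Submodule.Quotient.mk ⟨x w, hx w⟩)) = Submodule.Quotient.mk ⟨_, hmem x hx⟩ := by
    intro x hx
    have e : (⟨_, hmem x hx⟩ : Z') = ∑ w ∈ x.support, ⟨ψ w (x w), hZ w _ (hx w)⟩ := by
      ext
      simp [Finsupp.sum]
    rw [map_sum, e, ← Submodule.mkQ_apply, map_sum]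
    refine Finset.sum_congr rfl fun w _ => ?_
    exact DirectSum.toModule_lof ℤ w _
  refine ⟨(AddEquiv.ofBijective Θ.toAddMonoidHom ⟨?_, ?_⟩).symm⟩
  · refine (injective_iff_map_eq_zero _).2 fun q hq => ?_
    choose y hy using fun w => Submodule.Quotient.mk_surjective _ (q w)
    let x : ι →₀ M := Finsupp.onFinset q.support (fun w => if w ∈ q.support then y w else 0)
      (fun w hw => by by_contra hn; simp [hn] at hw)
    have hx : ∀ w, x w ∈ Z w := fun w => by
      simp only [x, Finsupp.onFinset_apply]
      split_ifs
      exacts [(y w).2, zero_mem _]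
    have hxq : ∀ w, (Submodule.Quotient.mk ⟨x w, hx w⟩ : Z w ⧸ (B w).submoduleOf (Z w)) = q w := by
      intro w
      by_cases hw : w ∈ q.support
      · rw [← hy w]
        congr 1
        ext
        simp only [x, Finsupp.onFinset_apply, if_pos hw]
      · rw [DFinsupp.notMem_support_iff.1 hw]
        rw [Submodule.Quotient.mk_eq_zero]
        have : x w = 0 := by simp only [x, Finsupp.onFinset_apply, if_neg hw]
        change x w ∈ B w
        simp [this]
    have hq' : q = ∑ w ∈ x.support, DirectSum.of (fun w => Z w ⧸ (B w).submoduleOf (Z w)) w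
        (Submodule.Quotient.mk ⟨x w, hx w⟩) := by
      conv_lhs => rw [← DirectSum.sum_support_of q]
      simp only [hxq]
      refine (Finset.sum_subset Finsupp.support_onFinset_subset ?_).symm
      intro w _ hw
      rw [← hxq]
      have : x w = 0 := Finsupp.notMem_support_iff.1 hw
      have h0 : (Submodule.Quotient.mk ⟨x w, hx w⟩ : Z w ⧸ (B w).submoduleOf (Z w)) = 0 := by
        rw [Submodule.Quotient.mk_eq_zero]
        change x w ∈ B w
        simp [this]
      rw [h0, map_zero]
    have h1 := hΘ x hx
    rw [← hq'] at h1
    have h2 := h1.symm.trans hq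
    rw [Submodule.Quotient.mk_eq_zero] at h2
    have h3 := hinj x hx h2
    ext w
    rw [← hxq w]
    exact (Submodule.Quotient.mk_eq_zero _).2 (h3 w)
  · intro z
    obtain ⟨⟨z, hz⟩, rfl⟩ := Submodule.Quotient.mk_surjective _ z
    obtain ⟨x, hx, rfl⟩ := hsurj z hz
    exact ⟨_, hΘ x hx⟩

/-- A sum over `w` of groups depending only on `In w`, rewritten with the spans of the parts of a
linearly independent family on which `In` is constant. -/
theorem nonempty_directSum_tensor_span_addEquiv {W 𝒯 A : Type*} [AddCommGroup A]
    {p : 𝒯 → Prop} (In : W → 𝒯) (hIn : ∀ w, p (In w)) (b : W → A) (hb : LinearIndependent ℤ b)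
    (H : 𝒯 → Submodule ℤ A) (hH : ∀ T, H T = Submodule.span ℤ (b '' {w | In w = T}))
    (G : 𝒯 → Type*) [∀ T, AddCommGroup (G T)] :
    Nonempty ((⨁ w, G (In w)) ≃+ ⨁ T : {T // p T}, G T ⊗[ℤ] H T) := by
  classical
  let J := Σ T : {T // p T}, {w // In w = T.1}
  let e : W ≃ J :=
    { toFun := fun w => ⟨⟨In w, hIn w⟩, w, rfl⟩
      invFun := fun j => j.2.1
      left_inv := fun w => rfl
      right_inv := by
        rintro ⟨⟨T, hT⟩, w, hw⟩
        dsimp only at hw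
        subst hw
        rfl }
  have e1 : (⨁ w, G (In w)) ≃+ ⨁ j : J, G (In (e.symm j)) :=
    DirectSum.equivCongrLeft e
  have e2 : (⨁ j : J, G (In (e.symm j))) ≃+ ⨁ j : J, G j.1.1 :=
    DirectSum.congrAddEquiv fun j => by
      have h : In (e.symm j) = j.1.1 := j.2.2
      rw [h]
  have e3 : (⨁ j : J, G j.1.1) ≃+ ⨁ T : {T // p T}, ⨁ _w : {w // In w = T.1}, G T.1 :=
    DirectSum.sigmaCurryEquiv (α := fun T : {T // p T} => {w // In w = T.1})
      (δ := fun T _ => G T.1)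
  have e4 : ∀ T : {T // p T}, (⨁ _w : {w // In w = T.1}, G T.1) ≃+
      G T ⊗[ℤ] H T := fun T => by
    have hli : LinearIndependent ℤ fun w : {w // In w = T.1} => b w :=
      hb.comp _ Subtype.val_injective
    have hspan : H T = Submodule.span ℤ (range fun w : {w // In w = T.1} => b w) := by
      rw [hH]
      congr 1
      ext a
      simp
    -- The span is free on the family, and tensoring `G T` with a free group gives one copy of `G T`
    -- per basis element.
    refine AddEquiv.symm (AddEquiv.trans ?_ (finsuppLequivDFinsupp ℤ).toAddEquiv)
    refine AddEquiv.trans ?_ (TensorProduct.finsuppScalarRight ℤ ℤ (G T.1) _).toAddEquiv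
    exact (TensorProduct.congr (LinearEquiv.refl ℤ _)
      ((LinearEquiv.ofEq _ _ hspan).trans (Module.Basis.span hli).repr)).toAddEquiv
  exact ⟨((e1.trans e2).trans e3).trans (DirectSum.congrAddEquiv e4)⟩

end CoxeterDavis

/-! ### Homology of the basic construction -/

namespace CellularHomology

open RelCWComplex

theorem chainsIn_empty {X : Type*} [TopologicalSpace X] (C : Set X) [CWComplex C] (n : ℕ) :
    chainsIn C ∅ n = ⊥ := by
  have h : {c : cell C n | openCell n c ⊆ ∅} = ∅ :=
    eq_empty_of_forall_notMem fun c hc => (openCell_nonempty n c).ne_empty (subset_empty_iff.1 hc)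
  rw [chainsIn, h, Finsupp.supported_empty]

end CellularHomology

namespace CoxeterDavis

open RelCWComplex CellularHomology BasicConstruction

variable {S : Type*} {M : CoxeterMatrix S} {W : Type*} [Group W] (cs : CoxeterSystem M W)

instance finite_special_rightIn (w : W) : Finite (special cs (rightIn cs w)) :=
  isSpherical_rightIn cs w

theorem neg_one_pow_length_mul_simple (u : W) (s : S) :
    (-1 : ℤ) ^ cs.length (u * cs.simple s) = -(-1) ^ cs.length u := by
  rcases cs.length_mul_simple u s with h | h
  · rw [h, pow_succ]
    ring
  · rw [← h, pow_succ]
    ring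

theorem coeff_of_mul_alternation (w : W) [Fintype (special cs (rightIn cs w))] :
    (MonoidAlgebra.of ℤ W w * alternation cs (rightIn cs w)).coeff =
      ∑ u : special cs (rightIn cs w),
        (-1 : ℤ) ^ cs.length (u : W) • Finsupp.single (w * u) (1 : ℤ) := by
  rw [alternation, finsum_eq_sum_of_fintype, Finset.mul_sum, ← MonoidAlgebra.coeffLinearEquiv_apply ℤ,
    map_sum]
  refine Finset.sum_congr rfl fun u _ => ?_
  rw [mul_smul_comm, map_smul, ← map_mul]
  rfl

/-- The element indexed by `w` is `e_w` plus a combination of basis vectors of strictly shorter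
elements. -/
theorem linearIndependent_of_mul_alternation :
    LinearIndependent ℤ fun w : W => MonoidAlgebra.of ℤ W w * alternation cs (rightIn cs w) := by
  classical
  have (w : W) : Fintype (special cs (rightIn cs w)) := Fintype.ofFinite _
  refine LinearIndependent.of_comp (MonoidAlgebra.coeffLinearEquiv ℤ).toLinearMap
    (linearIndependent_iff.2 fun x hx => ?_)
  ext w
  refine eq_zero_of_linearCombination_of_unitriangular (P := fun _ => True) (i := id)
    (ρ := cs.length) (fun _ h => absurd trivial h) ?_ ?_ hx trivial
  · intro w _
    change (MonoidAlgebra.of ℤ W w * alternation cs (rightIn cs w)).coeff w = 1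
    rw [coeff_of_mul_alternation, Finsupp.finsetSum_apply, Finset.sum_eq_single 1]
    · simp
    · intro u _ hu
      have : w * (u : W) ≠ w := by simpa using hu
      simp [this]
    · simp
  · intro w _ w' _ h hne
    change (MonoidAlgebra.of ℤ W w * alternation cs (rightIn cs w)).coeff w' ≠ 0 at h
    rw [coeff_of_mul_alternation, Finsupp.finsetSum_apply] at h
    obtain ⟨u, -, hu⟩ := Finset.exists_ne_zero_of_sum_ne_zero h
    have e : w * u = w' := by
      by_contra hn
      simp [hn] at hu
    rw [← e]
    refine length_lt_of_mem_special_rightIn cs Subset.rfl u.2 fun h1 => hne ?_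
    rw [← e, h1, mul_one]

/-! ### Alternating translates and the splitting of the chain complex -/

section

variable {X : Type*} [TopologicalSpace X] [T2Space X] [CWComplex (univ : Set X)] (m : Mirrors S X)

/-- The alternating sum of the translates by the elements of `w W_{In(w)}`. -/
def alternatingTranslate (n : ℕ) (w : W) :
    Chains (univ : Set X) n →ₗ[ℤ] Chains (univ : Set (BasicConstruction cs m)) n :=
  ∑ᶠ u : special cs (rightIn cs w), (-1 : ℤ) ^ cs.length (u : W) • translate cs m (w * u) n

theorem alternatingTranslate_apply (n : ℕ) (w : W) [Fintype (special cs (rightIn cs w))]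
    (x : Chains (univ : Set X) n) :
    alternatingTranslate cs m n w x = ∑ u : special cs (rightIn cs w),
      (-1 : ℤ) ^ cs.length (u : W) • translate cs m (w * u) n x := by
  rw [alternatingTranslate, finsum_eq_sum_of_fintype]
  simp

theorem boundary_alternatingTranslate (n : ℕ) (w : W) (x : Chains (univ : Set X) (n + 1)) :
    boundary (univ : Set (BasicConstruction cs m)) n (alternatingTranslate cs m (n + 1) w x) =
      alternatingTranslate cs m n w (boundary (univ : Set X) n x) := by
  have : Fintype (special cs (rightIn cs w)) := Fintype.ofFinite _
  simp only [alternatingTranslate_apply, map_sum, map_smul, boundary_translate]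

/-- For `s` in both sets, the terms of `u` and `us` carry the same translate of `c` with opposite
signs. The pairing has no fixed point since `s ≠ 1`. -/
theorem alternatingTranslate_single_eq_zero {n : ℕ} {w : W} {c : cell (univ : Set X) n}
    (h : ¬ Disjoint (rightIn cs w) (mirrorsOf m n c)) (a : ℤ) :
    alternatingTranslate cs m n w (Finsupp.single c a) = 0 := by
  have : Fintype (special cs (rightIn cs w)) := Fintype.ofFinite _
  obtain ⟨s, hs, hsc⟩ := not_disjoint_iff.1 h
  rw [alternatingTranslate_apply]
  refine Finset.sum_involution
    (fun u _ => u * ⟨cs.simple s, simple_mem_special cs hs⟩) ?_ ?_ (fun _ _ => Finset.mem_univ _) ?_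
  · intro u _
    have e : translateCell cs m (w * (u * cs.simple s)) n c = translateCell cs m (w * u) n c := by
      refine (translateCell_eq_iff cs m).2 ⟨rfl, ?_⟩
      have := simple_mem_special cs hsc
      simpa [mul_assoc] using this
    simp [translate, e, neg_one_pow_length_mul_simple]
  · intro u _ _ h1
    have h2 : (⟨cs.simple s, simple_mem_special cs hs⟩ : special cs (rightIn cs w)) = 1 := by
      simpa using h1
    have h3 : cs.simple s = 1 := congrArg Subtype.val h2
    have := cs.length_simple s
    rw [h3, cs.length_one] at this
    exact absurd this zero_ne_one
  · intro u _
    ext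
    simp [mul_assoc]

theorem alternatingTranslate_eq_zero {n : ℕ} {w : W} {x : Chains (univ : Set X) n}
    (hx : x ∈ chainsIn (univ : Set X) (mirrorUnion m (rightIn cs w)) n) :
    alternatingTranslate cs m n w x = 0 := by
  rw [← Finsupp.sum_single x, Finsupp.sum, map_sum]
  refine Finset.sum_eq_zero fun c hc => alternatingTranslate_single_eq_zero cs m ?_ _
  exact (openCell_subset_mirrorUnion_iff).1 ((Finsupp.mem_supported _ _).1 hx hc)

/-- No other term contributes to the cell `wc`: `w` is longest in `w W_{In(w)}` and shortest in `w
W_{S(c)}`, so no `u ≠ 1` lies in both subgroups. -/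
theorem alternatingTranslate_single_apply_self {n : ℕ} {w : W}
    {c : cell (univ : Set X) n} (h : Disjoint (rightIn cs w) (mirrorsOf m n c)) :
    alternatingTranslate cs m n w (Finsupp.single c 1) (translateCell cs m w n c) = 1 := by
  have : Fintype (special cs (rightIn cs w)) := Fintype.ofFinite _
  rw [alternatingTranslate_apply, Finsupp.finsetSum_apply, Finset.sum_eq_single 1]
  · simp [translate]
  · intro u _ hu
    have hne : translateCell cs m (w * u) n c ≠ translateCell cs m w n c := by
      intro e
      have h1 := inv_mem ((translateCell_eq_iff cs m).1 e).2
      have h2 := length_mul_of_disjoint_rightIn cs h h1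
      have h3 := length_lt_of_mem_special_rightIn cs Subset.rfl u.2 fun h => hu (Subtype.ext h)
      simp at h2
      lia
    simp [translate, hne]
  · simp

/-- Some `wu` lies in the coset of `W_{S(c)}` whose shortest element is `w'`, so `l(w') ≤ l(wu) <
l(w)` unless `u = 1`. In that case uniqueness of the shortest element gives `w = w'`. -/
theorem length_lt_of_alternatingTranslate_ne_zero {n : ℕ} {w w' : W}
    {c c' : cell (univ : Set X) n} (hw : Disjoint (rightIn cs w) (mirrorsOf m n c))
    (hw' : Disjoint (rightIn cs w') (mirrorsOf m n c'))
    (h : alternatingTranslate cs m n w (Finsupp.single c 1) (translateCell cs m w' n c') ≠ 0)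
    (hne : (w', c') ≠ (w, c)) : cs.length w' < cs.length w := by
  have : Fintype (special cs (rightIn cs w)) := Fintype.ofFinite _
  rw [alternatingTranslate_apply, Finsupp.finsetSum_apply] at h
  obtain ⟨u, -, hu⟩ := Finset.exists_ne_zero_of_sum_ne_zero h
  have e : translateCell cs m (w * u) n c = translateCell cs m w' n c' := by
    by_contra hn
    simp [translate, hn] at hu
  obtain ⟨rfl, h1⟩ := (translateCell_eq_iff cs m).1 e
  have h2 := length_mul_of_disjoint_rightIn cs hw' (inv_mem h1)
  by_cases h3 : (u : W) = 1
  · rw [h3, mul_one] at h1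
    rw [eq_of_disjoint_rightIn cs hw hw' h1] at hne
    exact absurd rfl hne
  · have h4 := length_lt_of_mem_special_rightIn cs Subset.rfl u.2 h3
    simp at h2
    lia

theorem lsum_alternatingTranslate (n : ℕ) (x : W × cell (univ : Set X) n →₀ ℤ) :
    Finsupp.linearCombination ℤ
      (fun q : W × cell (univ : Set X) n =>
        alternatingTranslate cs m n q.1 (Finsupp.single q.2 1)) x =
      Finsupp.lsum ℤ (alternatingTranslate cs m n) (Finsupp.curryLinearEquiv ℤ x) := by
  suffices h : Finsupp.linearCombination ℤ
      (fun q : W × cell (univ : Set X) n =>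
        alternatingTranslate cs m n q.1 (Finsupp.single q.2 1)) =
      (Finsupp.lsum ℤ (alternatingTranslate cs m n)).comp
        (Finsupp.curryLinearEquiv ℤ).toLinearMap from LinearMap.congr_fun h x
  ext1 q
  ext1
  simp [Finsupp.curryLinearEquiv]

theorem surjective_lsum_alternatingTranslate (n : ℕ) :
    Function.Surjective (Finsupp.lsum ℤ (alternatingTranslate cs m n)) := by
  classical
  intro z
  obtain ⟨x, hx⟩ := surjective_linearCombination_of_unitriangular
    (P := fun q : W × cell (univ : Set X) n => Disjoint (rightIn cs q.1) (mirrorsOf m n q.2))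
    (i := fun q => translateCell cs m q.1 n q.2) (ρ := fun q => cs.length q.1)
    (v := fun q => alternatingTranslate cs m n q.1 (Finsupp.single q.2 1))
    (fun e => by
      obtain ⟨w, c, rfl⟩ := exists_translateCell cs m e
      obtain ⟨u, hu, hd⟩ := exists_disjoint_rightIn cs (mirrorsOf m n c) w
      refine ⟨(w * u, c), hd, (translateCell_eq_iff cs m).2 ⟨rfl, ?_⟩⟩
      simpa using hu)
    (fun q hq => alternatingTranslate_single_apply_self cs m hq)
    (fun q hq q' hq' h hne => length_lt_of_alternatingTranslate_ne_zero cs m hq hq' h hne) z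
  exact ⟨_, (lsum_alternatingTranslate cs m n x).symm.trans hx⟩

/-- Only pairs `(w, c)` with `In(w)` and `S(c)` disjoint contribute, and they contribute independent
vectors. A family in the kernel thus consists of chains of the subcomplexes `X^{In(w)}`. -/
theorem mem_chainsIn_of_lsum_alternatingTranslate_eq_zero {n : ℕ}
    {x : W →₀ Chains (univ : Set X) n}
    (hx : Finsupp.lsum ℤ (alternatingTranslate cs m n) x = 0) (w : W) :
    x w ∈ chainsIn (univ : Set X) (mirrorUnion m (rightIn cs w)) n := by
  classical
  obtain ⟨y, rfl⟩ := (Finsupp.curryLinearEquiv ℤ).surjective x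
  rw [← lsum_alternatingTranslate] at hx
  refine (Finsupp.mem_supported _ _).2 fun c hc => ?_
  change openCell n c ⊆ _
  rw [openCell_subset_mirrorUnion_iff]
  intro hd
  refine Finsupp.mem_support_iff.1 hc ?_
  exact eq_zero_of_linearCombination_of_unitriangular
    (P := fun q : W × cell (univ : Set X) n => Disjoint (rightIn cs q.1) (mirrorsOf m n q.2))
    (i := fun q => translateCell cs m q.1 n q.2) (ρ := fun q => cs.length q.1)
    (fun q hq => alternatingTranslate_single_eq_zero cs m hq 1)
    (fun q hq => alternatingTranslate_single_apply_self cs m hq)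
    (fun q hq q' hq' h hne => length_lt_of_alternatingTranslate_ne_zero cs m hq hq' h hne) hx hd

theorem boundary_lsum_alternatingTranslate {n : ℕ} (x : W →₀ Chains (univ : Set X) (n + 1)) :
    boundary (univ : Set (BasicConstruction cs m)) n
        (Finsupp.lsum ℤ (alternatingTranslate cs m (n + 1)) x) =
      Finsupp.lsum ℤ (alternatingTranslate cs m n)
        (Finsupp.mapRange.linearMap (boundary (univ : Set X) n) x) := by
  induction x using Finsupp.induction_linear with
  | zero => simp
  | add x y hx hy => simp only [map_add, hx, hy]
  | single w x =>
    simp [boundary_alternatingTranslate]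

/-- The homology of `𝒰(W, X)` is the sum over `w ∈ W` of the groups `H_i(X, X^{In(w)})`. -/
theorem nonempty_homology_addEquiv (i : ℕ) :
    Nonempty (Homology (univ : Set (BasicConstruction cs m)) i ≃+
      ⨁ w : W, RelHomology (univ : Set X) (mirrorUnion m (rightIn cs w)) i) := by
  refine nonempty_directSum_subquotient_addEquiv
    (fun w => relCycles (univ : Set X) (mirrorUnion m (rightIn cs w)) i)
    (fun w => relBoundaries (univ : Set X) (mirrorUnion m (rightIn cs w)) i)
    (relCycles (univ : Set (BasicConstruction cs m)) ∅ i)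
    (relBoundaries (univ : Set (BasicConstruction cs m)) ∅ i)
    (alternatingTranslate cs m i) ?_ ?_ ?_ ?_
  · intro w x hx
    cases i with
    | zero => trivial
    | succ n =>
      change boundary _ n _ ∈ chainsIn _ _ n
      rw [boundary_alternatingTranslate, alternatingTranslate_eq_zero cs m hx]
      exact zero_mem _
  · intro w x hx
    obtain ⟨_, ⟨y, rfl⟩, k, hk, rfl⟩ := Submodule.mem_sup.1 hx
    refine Submodule.mem_sup_left ⟨alternatingTranslate cs m (i + 1) w y, ?_⟩
    rw [map_add, alternatingTranslate_eq_zero cs m hk, add_zero, boundary_alternatingTranslate]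
  · intro z hz
    obtain ⟨x, rfl⟩ := surjective_lsum_alternatingTranslate cs m i z
    refine ⟨x, fun w => ?_, rfl⟩
    cases i with
    | zero => trivial
    | succ n =>
      change boundary _ n _ ∈ chainsIn _ _ n at hz
      rw [chainsIn_empty, Submodule.mem_bot, boundary_lsum_alternatingTranslate] at hz
      exact mem_chainsIn_of_lsum_alternatingTranslate_eq_zero cs m hz w
  · intro x _ hx w
    obtain ⟨_, ⟨y, rfl⟩, k, hk, hyx⟩ := Submodule.mem_sup.1 hx
    rw [chainsIn_empty, Submodule.mem_bot] at hk
    rw [hk, add_zero] at hyx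
    obtain ⟨y, rfl⟩ := surjective_lsum_alternatingTranslate cs m (i + 1) y
    rw [boundary_lsum_alternatingTranslate] at hyx
    -- Being in the kernel, `x - ∂y` is a family of chains of the `X^{In(w)}`, so each `x w` is a
    -- relative boundary.
    have h0 : Finsupp.lsum ℤ (alternatingTranslate cs m i)
        (x - Finsupp.mapRange.linearMap (boundary (univ : Set X) i) y) = 0 := by
      rw [map_sub, hyx]
      exact sub_self _
    have := mem_chainsIn_of_lsum_alternatingTranslate_eq_zero cs m h0 w
    refine Submodule.mem_sup.2 ⟨boundary (univ : Set X) i (y w), ⟨y w, rfl⟩, _, this, ?_⟩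
    simp

end

end CoxeterDavis

/-! ### Finitely supported cohomology of the basic construction -/

namespace CoxeterDavis

open RelCWComplex CellularHomology BasicConstruction

/-- Finitely supported families of functions on a finite type as functions of two variables. -/
def finsuppFamilyEquiv (ι K : Type*) [Finite K] : (ι × K →₀ ℤ) ≃ₗ[ℤ] ι →₀ K → ℤ :=
  (Finsupp.curryLinearEquiv ℤ).trans
    (Finsupp.mapRange.linearEquiv (Finsupp.linearEquivFunOnFinite ℤ ℤ _))

theorem finsuppFamilyEquiv_apply {ι K : Type*} [Finite K] (x : ι × K →₀ ℤ) (w : ι) (c : K) :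
    finsuppFamilyEquiv ι K x w c = x (w, c) := rfl

variable {S : Type*} {M : CoxeterMatrix S} {W : Type*} [Group W] (cs : CoxeterSystem M W)

/-- Indexing by inverses turns `In'` into `In`, so that the right-handed length lemmas serve both
halves. -/
theorem coeff_symmetrization_mul_of_inv (w : W) [Fintype (special cs (rightIn cs w))] :
    (symmetrization cs (leftIn cs w⁻¹) * MonoidAlgebra.of ℤ W w⁻¹).coeff =
      ∑ u : special cs (rightIn cs w), Finsupp.single ((w * u)⁻¹) (1 : ℤ) := by
  rw [leftIn_inv, symmetrization, finsum_eq_sum_of_fintype, Finset.sum_mul,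
    ← MonoidAlgebra.coeffLinearEquiv_apply ℤ, map_sum,
    ← Equiv.sum_comp (Equiv.inv (special cs (rightIn cs w)))]
  refine Finset.sum_congr rfl fun u _ => ?_
  rw [← map_mul, mul_inv_rev]
  rfl

theorem linearIndependent_symmetrization_mul_of_inv :
    LinearIndependent ℤ fun w : W =>
      symmetrization cs (leftIn cs w⁻¹) * MonoidAlgebra.of ℤ W w⁻¹ := by
  classical
  have (w : W) : Fintype (special cs (rightIn cs w)) := Fintype.ofFinite _
  refine LinearIndependent.of_comp (MonoidAlgebra.coeffLinearEquiv ℤ).toLinearMap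
    (linearIndependent_iff.2 fun x hx => ?_)
  ext w
  refine eq_zero_of_linearCombination_of_unitriangular (P := fun _ => True) (i := fun w => w⁻¹)
    (ρ := cs.length) (fun _ h => absurd trivial h) ?_ ?_ hx trivial
  · intro w _
    change (symmetrization cs (leftIn cs w⁻¹) * MonoidAlgebra.of ℤ W w⁻¹).coeff w⁻¹ = 1
    rw [coeff_symmetrization_mul_of_inv, Finsupp.finsetSum_apply, Finset.sum_eq_single 1]
    · simp
    · intro u _ hu
      have : (w * (u : W))⁻¹ ≠ w⁻¹ := by simpa using hu
      rw [Finsupp.single_eq_of_ne' this]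
    · simp
  · intro w _ w' _ h hne
    change (symmetrization cs (leftIn cs w⁻¹) * MonoidAlgebra.of ℤ W w⁻¹).coeff w'⁻¹ ≠ 0 at h
    rw [coeff_symmetrization_mul_of_inv, Finsupp.finsetSum_apply] at h
    obtain ⟨u, -, hu⟩ := Finset.exists_ne_zero_of_sum_ne_zero h
    have e : w * u = w' := by
      by_contra hn
      exact hu (Finsupp.single_eq_of_ne' (inv_injective.ne hn))
    rw [← e]
    refine length_lt_of_mem_special_rightIn cs Subset.rfl u.2 fun h1 => hne ?_
    rw [← e, h1, mul_one]

theorem AHat_eq_span (T : Set S) :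
    AHat cs T = Submodule.span ℤ
      ((fun w : W => symmetrization cs (leftIn cs w⁻¹) * MonoidAlgebra.of ℤ W w⁻¹) ''
        {w | rightIn cs w = T}) := by
  rw [AHat]
  congr 1
  ext a
  constructor
  · rintro ⟨w, hw, rfl⟩
    refine ⟨w⁻¹, ?_, by simp⟩
    rw [mem_ofPred_eq, rightIn_inv]
    exact hw
  · rintro ⟨w, hw, rfl⟩
    refine ⟨w⁻¹, ?_, rfl⟩
    rw [mem_ofPred_eq, leftIn_inv]
    exact hw

/-! ### Extension of relative cochains along cosets -/

section

variable {X : Type*} [TopologicalSpace X] [T2Space X] [CWComplex (univ : Set X)] (m : Mirrors S X)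

/-- The cell `c` of `X` underlying a cell `wc` of `𝒰(W, X)`. -/
def baseCell (n : ℕ) (e : cell (univ : Set (BasicConstruction cs m)) n) : cell (univ : Set X) n :=
  Sigma.fst (show Cell cs m n from e)

theorem baseCell_translateCell (w : W) (n : ℕ) (c : cell (univ : Set X) n) :
    baseCell cs m n (translateCell cs m w n c) = c := rfl

/-- The cochains of `(X, X^{S-T})` live on the cells with `S(c) ⊆ T`; for `T = In(w)` this is the
condition built into `cosetExtend`. -/
theorem mem_relCochains_iff {T : Set S} {n : ℕ} {g : Cochains (univ : Set X) n} :
    g ∈ relCochains (univ : Set X) (mirrorUnion m Tᶜ) n ↔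
      ∀ c, ¬ mirrorsOf m n c ⊆ T → g c = 0 := by
  have (c : cell (univ : Set X) n) :
      openCell n c ⊆ mirrorUnion m Tᶜ ↔ ¬ mirrorsOf m n c ⊆ T := by
    rw [openCell_subset_mirrorUnion_iff, disjoint_compl_left_iff_subset]
  simp only [← this]
  rfl

open scoped Classical in
/-- The extension of cochains of `(X, X^{S - In(w)})` which is constant along `w W_{In(w)}` and
vanishes on the other translates of `X`. -/
def cosetExtend (n : ℕ) (w : W) :
    Cochains (univ : Set X) n →ₗ[ℤ] Cochains (univ : Set (BasicConstruction cs m)) n where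
  toFun g e := if mirrorsOf m n (baseCell cs m n e) ⊆ rightIn cs w ∧
      ∃ u ∈ special cs (rightIn cs w), translateCell cs m (w * u) n (baseCell cs m n e) = e
    then g (baseCell cs m n e) else 0
  map_add' f g := by
    funext e
    simp only [Pi.add_apply]
    split_ifs <;> simp
  map_smul' r f := by
    funext e
    simp

variable {m}

-- When `S(c) ⊆ In(w)`, the stabilizer `W_{S(c)}` is contained in `W_{In(w)}`, so whether `x` lies
-- in `w W_{In(w)}` depends only on the cell `xc`.
open scoped Classical in
theorem cosetExtend_translateCell {n : ℕ} {w x : W} {g : Cochains (univ : Set X) n}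
    {c : cell (univ : Set X) n} : cosetExtend cs m n w g (translateCell cs m x n c) =
      if mirrorsOf m n c ⊆ rightIn cs w ∧ w⁻¹ * x ∈ special cs (rightIn cs w) then g c else 0 := by
  refine if_congr (and_congr_right fun h => ?_) rfl rfl
  rw [baseCell_translateCell] at h ⊢
  constructor
  · rintro ⟨u, hu, e⟩
    have := mul_mem hu (special_mono cs h ((translateCell_eq_iff cs m).1 e).2)
    simpa [mul_assoc] using this
  · intro hx
    exact ⟨_, hx, by simp⟩

open scoped Classical in
theorem restrict_cosetExtend {n : ℕ} {w : W} (x : W) {g : Cochains (univ : Set X) n}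
    (hg : g ∈ relCochains (univ : Set X) (mirrorUnion m (rightIn cs w)ᶜ) n) :
    restrict cs m x n (cosetExtend cs m n w g) =
      if w⁻¹ * x ∈ special cs (rightIn cs w) then g else 0 := by
  funext c
  rw [restrict_apply, cosetExtend_translateCell]
  by_cases h : mirrorsOf m n c ⊆ rightIn cs w
  · by_cases hx : w⁻¹ * x ∈ special cs (rightIn cs w)
    · rw [if_pos ⟨h, hx⟩, if_pos hx]
    · rw [if_neg fun h => hx h.2, if_neg hx]
      rfl
  · rw [if_neg fun h' => h h'.1]
    have := (mem_relCochains_iff m).1 hg c h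
    split_ifs
    exacts [this.symm, rfl]

/-- It suffices to compare restrictions to the translates `xX`. There the extension of a relative
cochain is the cochain itself or zero, and coboundaries preserve relative cochains. -/
theorem coboundary_cosetExtend {n : ℕ} {w : W} {g : Cochains (univ : Set X) n}
    (hg : g ∈ relCochains (univ : Set X) (mirrorUnion m (rightIn cs w)ᶜ) n) :
    coboundary (univ : Set (BasicConstruction cs m)) n (cosetExtend cs m n w g) =
      cosetExtend cs m (n + 1) w (coboundary (univ : Set X) n g) := by
  classical
  refine eq_of_restrict_eq cs m fun x => ?_
  rw [restrict_coboundary, restrict_cosetExtend cs x hg,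
    restrict_cosetExtend cs x (coboundary_mem_relCochains m _ n hg)]
  split_ifs
  exacts [rfl, map_zero _]

theorem coboundary_lsum_cosetExtend {n : ℕ} {x : W →₀ Cochains (univ : Set X) n}
    (hx : ∀ w, x w ∈ relCochains (univ : Set X) (mirrorUnion m (rightIn cs w)ᶜ) n) :
    coboundary (univ : Set (BasicConstruction cs m)) n
        (Finsupp.lsum ℤ (cosetExtend cs m n) x) =
      Finsupp.lsum ℤ (cosetExtend cs m (n + 1))
        (Finsupp.mapRange.linearMap (coboundary (univ : Set X) n) x) := by
  rw [Finsupp.lsum_apply, Finsupp.lsum_apply, Finsupp.mapRange.linearMap_apply,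
    Finsupp.sum_mapRange_index (by simp), Finsupp.sum, map_sum]
  exact Finset.sum_congr rfl fun w _ => coboundary_cosetExtend cs (hx w)

section Compact

variable [CompactSpace X]

/-- The support consists of translates of the finitely many cells of `X` by the finite coset `w
W_{In(w)}`. -/
theorem cosetExtend_mem_finiteCochains {n : ℕ} (w : W) (g : Cochains (univ : Set X) n) :
    cosetExtend cs m n w g ∈
      finiteCochains (univ : Set (BasicConstruction cs m)) n := by
  have := finite_cell (X := X) n
  refine (finite_range fun p : special cs (rightIn cs w) × cell (univ : Set X) n =>
    translateCell cs m (w * p.1) n p.2).subset fun e he => ?_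
  classical
  obtain ⟨⟨-, u, hu, h⟩, -⟩ := ite_ne_right_iff.1 he
  exact ⟨(⟨u, hu⟩, _), h⟩

open scoped Classical in
/-- The extension of the cochain dual to a cell, as a finitely supported function. -/
def cosetExtendSingle (n : ℕ) (q : W × cell (univ : Set X) n) :
    cell (univ : Set (BasicConstruction cs m)) n →₀ ℤ :=
  Finsupp.ofSupportFinite (cosetExtend cs m n q.1 (Pi.single q.2 1))
    (cosetExtend_mem_finiteCochains cs q.1 _)

open scoped Classical in
theorem cosetExtendSingle_apply {n : ℕ} {q : W × cell (univ : Set X) n}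
    (e : cell (univ : Set (BasicConstruction cs m)) n) :
    cosetExtendSingle cs n q e = cosetExtend cs m n q.1 (Pi.single q.2 1) e := rfl

theorem cosetExtendSingle_eq_zero {n : ℕ} {q : W × cell (univ : Set X) n}
    (h : ¬ mirrorsOf m n q.2 ⊆ rightIn cs q.1) :
    cosetExtendSingle cs (m := m) n q = 0 := by
  classical
  ext e
  obtain ⟨x, c, rfl⟩ := exists_translateCell cs m e
  rw [cosetExtendSingle_apply, cosetExtend_translateCell]
  by_cases hc : c = q.2
  · subst hc
    rw [if_neg fun h' => h h'.1]
    rfl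
  · simp [hc]

theorem cosetExtendSingle_apply_self {n : ℕ} {q : W × cell (univ : Set X) n}
    (h : mirrorsOf m n q.2 ⊆ rightIn cs q.1) :
    cosetExtendSingle cs n q (translateCell cs m q.1 n q.2) = 1 := by
  classical
  rw [cosetExtendSingle_apply, cosetExtend_translateCell, if_pos ⟨h, by simp [one_mem]⟩]
  simp

theorem length_lt_of_cosetExtendSingle_ne_zero {n : ℕ} {q q' : W × cell (univ : Set X) n}
    (h : cosetExtendSingle cs n q (translateCell cs m q'.1 n q'.2) ≠ 0) (hne : q' ≠ q) :
    cs.length q'.1 < cs.length q.1 := by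
  classical
  rw [cosetExtendSingle_apply, cosetExtend_translateCell] at h
  obtain ⟨⟨-, hm⟩, hc⟩ := ite_ne_right_iff.1 h
  have hc : q'.2 = q.2 := by
    by_contra hn
    simp [hn] at hc
  have := length_lt_of_mem_special_rightIn cs Subset.rfl hm fun h1 =>
    hne (Prod.ext (inv_mul_eq_one.1 h1).symm hc)
  simpa using this

theorem coe_linearCombination_cosetExtendSingle (n : ℕ) [Finite (cell (univ : Set X) n)]
    (x : W × cell (univ : Set X) n →₀ ℤ) :
    ⇑(Finsupp.linearCombination ℤ (cosetExtendSingle cs (m := m) n) x) =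
      Finsupp.lsum ℤ (cosetExtend cs m n) (finsuppFamilyEquiv W (cell (univ : Set X) n) x) := by
  classical
  suffices h : Finsupp.lcoeFun.comp
      (Finsupp.linearCombination ℤ (cosetExtendSingle cs (m := m) n)) =
      (Finsupp.lsum ℤ (cosetExtend cs m n)).comp
        (finsuppFamilyEquiv W (cell (univ : Set X) n)).toLinearMap from
    LinearMap.congr_fun h x
  ext1 q
  ext1
  have e : finsuppFamilyEquiv W (cell (univ : Set X) n) (Finsupp.single q 1) =
      Finsupp.single q.1 (Pi.single q.2 1) := by
    ext w c
    rw [finsuppFamilyEquiv_apply]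
    by_cases hw : w = q.1
    · subst hw
      rw [Finsupp.single_eq_same, Finsupp.single_apply, Pi.single_apply]
      refine if_congr ⟨fun h => ?_, fun h => ?_⟩ rfl rfl
      · rw [h]
      · rw [h]
    · rw [Finsupp.single_eq_of_ne hw, Finsupp.single_eq_of_ne fun h => hw (by rw [← h])]
      rfl
  simp only [LinearMap.comp_apply, Finsupp.lsingle_apply, LinearEquiv.coe_coe, e,
    Finsupp.linearCombination_single, one_smul, Finsupp.lsum_single]
  rfl

/-- Every cell is `wc` with `w` longest in `w W_{S(c)}`, hence with `S(c) ⊆ In(w)`, so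
unitriangularity reaches all finitely supported cochains. -/
theorem exists_lsum_cosetExtend_eq {n : ℕ} (hm : ∀ c, IsSpherical cs (mirrorsOf m n c))
    {z : Cochains (univ : Set (BasicConstruction cs m)) n}
    (hz : z ∈ finiteCochains (univ : Set (BasicConstruction cs m)) n) :
    ∃ x : W →₀ Cochains (univ : Set X) n,
      (∀ w, x w ∈ relCochains (univ : Set X) (mirrorUnion m (rightIn cs w)ᶜ) n) ∧
        Finsupp.lsum ℤ (cosetExtend cs m n) x = z := by
  classical
  have := finite_cell (X := X) n
  let P := fun q : W × cell (univ : Set X) n => mirrorsOf m n q.2 ⊆ rightIn cs q.1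
  obtain ⟨x, hx⟩ := surjective_linearCombination_of_unitriangular (P := P)
    (i := fun q => translateCell cs m q.1 n q.2) (ρ := fun q => cs.length q.1)
    (v := cosetExtendSingle cs (m := m) n)
    (fun e => by
      obtain ⟨w, c, rfl⟩ := exists_translateCell cs m e
      obtain ⟨u, hu, hd⟩ := exists_subset_rightIn cs (hm c) w
      refine ⟨(w * u, c), hd, (translateCell_eq_iff cs m).2 ⟨rfl, ?_⟩⟩
      simpa using hu)
    (fun q hq => cosetExtendSingle_apply_self cs hq)
    (fun q _ q' _ h hne => length_lt_of_cosetExtendSingle_ne_zero cs h hne)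
    (Finsupp.ofSupportFinite z hz)
  -- Pairs outside `P` extend to zero; discarding them makes every member of the family a relative
  -- cochain.
  refine ⟨finsuppFamilyEquiv W (cell (univ : Set X) n) (x.filter P), fun w => ?_, ?_⟩
  · rw [mem_relCochains_iff]
    intro c hc
    exact Finsupp.filter_apply_neg P x hc
  · have h0 : Finsupp.linearCombination ℤ (cosetExtendSingle cs (m := m) n)
        (x.filter fun q => ¬ P q) = 0 := by
      rw [Finsupp.linearCombination_apply]
      refine Finset.sum_eq_zero fun q hq => ?_
      rw [Finsupp.support_filter, Finset.mem_filter] at hq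
      beta_reduce
      rw [cosetExtendSingle_eq_zero cs hq.2, smul_zero]
    rw [← Finsupp.filter_add_filter_not x P, map_add, h0, add_zero] at hx
    rw [← coe_linearCombination_cosetExtendSingle, hx]
    rfl

/-- Relative cochains form a subgroup rather than a quotient, so injectivity is strict here, while
for chains the kernel is the chains of the subcomplexes. -/
theorem eq_zero_of_lsum_cosetExtend_eq_zero {n : ℕ} {x : W →₀ Cochains (univ : Set X) n}
    (hx : ∀ w, x w ∈ relCochains (univ : Set X) (mirrorUnion m (rightIn cs w)ᶜ) n)
    (h0 : Finsupp.lsum ℤ (cosetExtend cs m n) x = 0) : x = 0 := by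
  classical
  have := finite_cell (X := X) n
  obtain ⟨y, rfl⟩ := (finsuppFamilyEquiv W (cell (univ : Set X) n)).surjective x
  rw [← coe_linearCombination_cosetExtendSingle] at h0
  ext w c
  by_cases hc : mirrorsOf m n c ⊆ rightIn cs w
  · exact eq_zero_of_linearCombination_of_unitriangular
      (P := fun q : W × cell (univ : Set X) n => mirrorsOf m n q.2 ⊆ rightIn cs q.1)
      (i := fun q => translateCell cs m q.1 n q.2) (ρ := fun q => cs.length q.1)
      (fun q hq => cosetExtendSingle_eq_zero cs hq)
      (fun q hq => cosetExtendSingle_apply_self cs hq)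
      (fun q _ q' _ h hne => length_lt_of_cosetExtendSingle_ne_zero cs h hne)
      (DFunLike.coe_injective h0) hc
  · exact (mem_relCochains_iff m).1 (hx w) c hc

/-- For compact `X` with finite stabilizers, the finitely supported cohomology of `𝒰(W, X)` is the
sum over `w ∈ W` of the groups `H^i(X, X^{S - In(w)})`. -/
theorem nonempty_finiteCohomology_addEquiv (hm : ∀ n c, IsSpherical cs (mirrorsOf m n c)) (i : ℕ) :
    Nonempty (FiniteCohomology (univ : Set (BasicConstruction cs m)) i ≃+
      ⨁ w : W, RelCohomology (univ : Set X) (mirrorUnion m (rightIn cs w)ᶜ) i) := by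
  refine nonempty_directSum_subquotient_addEquiv
    (fun w => cocycles (univ : Set X) (relCochains _ (mirrorUnion m (rightIn cs w)ᶜ)) i)
    (fun w => coboundaries (univ : Set X) (relCochains _ (mirrorUnion m (rightIn cs w)ᶜ)) i)
    (cocycles (univ : Set (BasicConstruction cs m)) (finiteCochains _) i)
    (coboundaries (univ : Set (BasicConstruction cs m)) (finiteCochains _) i)
    (cosetExtend cs m i) ?_ ?_ ?_ ?_
  · rintro w x ⟨hx, hx0⟩
    refine ⟨cosetExtend_mem_finiteCochains cs w x, ?_⟩
    rw [SetLike.mem_coe, LinearMap.mem_ker] at hx0 ⊢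
    rw [coboundary_cosetExtend cs hx, hx0, map_zero]
  · intro w x hx
    cases i with
    | zero =>
      rw [(Submodule.mem_bot ℤ).1 hx, map_zero]
      exact zero_mem _
    | succ n =>
      obtain ⟨y, hy, rfl⟩ := hx
      exact ⟨_, cosetExtend_mem_finiteCochains cs w y, coboundary_cosetExtend cs hy⟩
  · rintro z ⟨hz, hz0⟩
    obtain ⟨x, hx, rfl⟩ := exists_lsum_cosetExtend_eq cs (hm i) hz
    refine ⟨x, fun w => ⟨hx w, ?_⟩, rfl⟩
    rw [SetLike.mem_coe, LinearMap.mem_ker, coboundary_lsum_cosetExtend cs hx] at hz0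
    have := eq_zero_of_lsum_cosetExtend_eq_zero cs
      (fun w => coboundary_mem_relCochains m _ i (hx w)) hz0
    exact DFunLike.congr_fun this w
  · intro x hx hB w
    cases i with
    | zero =>
      have := eq_zero_of_lsum_cosetExtend_eq_zero cs (fun w => (hx w).1)
        ((Submodule.mem_bot ℤ).1 hB)
      rw [this]
      exact zero_mem _
    | succ n =>
      obtain ⟨y, hy, hyx⟩ := hB
      obtain ⟨y, hy', rfl⟩ := exists_lsum_cosetExtend_eq cs (hm n) hy
      rw [coboundary_lsum_cosetExtend cs hy'] at hyx
      have h0 := eq_zero_of_lsum_cosetExtend_eq_zero cs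
        (x := Finsupp.mapRange.linearMap (coboundary (univ : Set X) n) y - x)
        (fun w => sub_mem (coboundary_mem_relCochains m _ n (hy' w)) (hx w).1)
        (by rw [map_sub, hyx]; exact sub_self _)
      exact ⟨y w, hy' w, DFunLike.congr_fun (sub_eq_zero.1 h0) w⟩

end Compact

end

end CoxeterDavis

end

/-! ### Sorting the sums over `W` by `In(w)` -/

theorem theorem3p5 {S : Type*} {M : CoxeterMatrix S} {W : Type*} [Group W]
    (cs : CoxeterSystem M W) {X : Type*} [TopologicalSpace X] [T2Space X]
    [CWComplex (Set.univ : Set X)] (m : CoxeterDavis.Mirrors S X) (i : ℕ) :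
    (CompactSpace X →
      (∀ U : Set S, ¬ CoxeterDavis.IsSpherical cs U → CoxeterDavis.mirrorInter m U = ∅) →
      Nonempty
        (CellularHomology.FiniteCohomology
            (Set.univ : Set (CoxeterDavis.BasicConstruction cs m)) i ≃+
          ⨁ T : {T : Set S // CoxeterDavis.IsSpherical cs T},
            CellularHomology.RelCohomology (Set.univ : Set X)
                (CoxeterDavis.mirrorUnion m ((T : Set S)ᶜ)) i ⊗[ℤ]
              CoxeterDavis.AHat cs (T : Set S))) ∧
    Nonempty
      (CellularHomology.Homology (Set.univ : Set (CoxeterDavis.BasicConstruction cs m)) i ≃+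
        ⨁ T : {T : Set S // CoxeterDavis.IsSpherical cs T},
          CellularHomology.RelHomology (Set.univ : Set X)
              (CoxeterDavis.mirrorUnion m (T : Set S)) i ⊗[ℤ]
            CoxeterDavis.HHat cs (T : Set S)) := by
  constructor
  · intro _ hm
    obtain ⟨e⟩ := CoxeterDavis.nonempty_finiteCohomology_addEquiv cs
      (CoxeterDavis.isSpherical_mirrorsOf cs hm) i
    obtain ⟨e'⟩ := CoxeterDavis.nonempty_directSum_tensor_span_addEquiv
      (p := CoxeterDavis.IsSpherical cs) (CoxeterDavis.rightIn cs)
      (CoxeterDavis.isSpherical_rightIn cs) _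
      (CoxeterDavis.linearIndependent_symmetrization_mul_of_inv cs) (CoxeterDavis.AHat cs)
      (CoxeterDavis.AHat_eq_span cs)
      (fun T => CellularHomology.RelCohomology (Set.univ : Set X) (CoxeterDavis.mirrorUnion m Tᶜ) i)
    exact ⟨e.trans e'⟩
  · obtain ⟨e⟩ := CoxeterDavis.nonempty_homology_addEquiv cs m i
    obtain ⟨e'⟩ := CoxeterDavis.nonempty_directSum_tensor_span_addEquiv
      (p := CoxeterDavis.IsSpherical cs) (CoxeterDavis.rightIn cs)
      (CoxeterDavis.isSpherical_rightIn cs) _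
      (CoxeterDavis.linearIndependent_of_mul_alternation cs) (CoxeterDavis.HHat cs)
      (fun _ => rfl)
      (fun T => CellularHomology.RelHomology (Set.univ : Set X) (CoxeterDavis.mirrorUnion m T) i)
    exact ⟨e.trans e'⟩
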